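/- Let $U\subset\mathbb R^5$ be open, with coordinates $(x,y,z,p,r)$, and let $F,H$ be smooth real functions on $U$. Put $D=\partial_x+p\,\partial_z+r\,\partial_p+H\,\partial_r$ and $\Delta=\partial_y+F\partial_z+(DF)\partial_p+(D^2F)\partial_r$, and assume $F_r=0$, $F_{pp}\neq0$ everywhere and $D^3F=\Delta H$ on $U$ (the system $z_y=F$, $z_{xxx}=H$ with $p=z_x$, $r=z_{xx}$). Let $$\omega_0^1=dz-p\,dx-F\,dy,\quad \omega_0^2=dp-r\,dx-DF\,dy,\quad \omega_0^3=dr-H\,dx-D^2F\,dy,\quad \omega_0^4=dx,\quad \omega_0^5=dy,$$ and define the adapted coframe $(\omega^1,\dots,\omega^5)$ on $U$ by $$\begin{pmatrix}\omega^1\\\omega^2\\\omega^3\\\omega^4\\\omega^5\end{pmatrix}=\begin{pmatrix}-1&0&0&0&0\\0&1&0&0&0\\ \frac{2H_r^2+9H_p-3DH_r}{18}&\frac{H_r}{3}&-1&0&0\\0&0&0&1&F_p\\ \frac{3F_{pp}F_{pppp}-5F_{ppp}^2}{18F_{pp}^2}&0&0&\frac{F_{ppp}}{3F_{pp}}&\frac{F_{ppp}F_p-3F_{pp}^2}{3F_{pp}}\end{pmatrix}\begin{pmatrix}\omega_0^1\\\omega_0^2\\\omega_0^3\\\omega_0^4\\\omega_0^5\end{pmatrix}.$$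 On $\mathcal G^9=U\times\{(\rho,\phi,f,\bar f)\in\mathbb R^4:\rho>0\}$ let $\theta=S\,\omega$, where $$S=\begin{pmatrix}\rho^2&0&0&0&0\\ f&\rho e^{\phi}&0&0&0\\ \frac{f^2}{2\rho^2}&\frac{f e^{\phi}}{\rho}&e^{2\phi}&0&0\\ \bar f&0&0&\rho e^{-\phi}&0\\ -\frac{\bar f^2}{2\rho^2}&0&0&-\frac{\bar f e^{-\phi}}{\rho}&e^{-2\phi}\end{pmatrix}$$ (here $f^2,\bar f^2$ are squares). Define on $U$ $$I^1=-\tfrac1{54}\big(9D^2H_r-27DH_p-18\,(DH_r)H_r+18H_pH_r+4H_r^3+54H_z\big),$$ $$I^2=\frac{40F_{ppp}^3-45F_{pp}F_{ppp}F_{pppp}+9F_{pp}^2F_{ppppp}}{54F_{pp}^3},\qquad I^3=\frac{2F_{ppp}+F_{pp}H_{rr}}{3F_{pp}}.$$ (1) There exist smooth 1-forms $\Omega_1,\dots,\Omega_4$ on $\mathcal G^9$ such that $\theta^1,\dots,\theta^5,\Omega_1,\dots,\Omega_4$ are linearly independent at every point and $$\begin{aligned} d\theta^1&=-\theta^1\wedge\Omega_1+\theta^2\wedge\theta^4,\\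 d\theta^2&=\theta^2\wedge(\Omega_2-\tfrac12\Omega_1)-\theta^1\wedge\Omega_3+\theta^3\wedge\theta^4,\\ d\theta^3&=2\theta^3\wedge\Omega_2-\theta^2\wedge\Omega_3+\tfrac{e^{3\phi}}{\rho^3}I^1\,\theta^1\wedge\theta^4+\tfrac{e^{-\phi}}{\rho}I^3\,\theta^2\wedge\theta^3+Q\,\theta^1\wedge\theta^3,\\ d\theta^4&=-\theta^2\wedge\theta^5-\theta^4\wedge(\tfrac12\Omega_1+\Omega_2)-\theta^1\wedge\Omega_4,\\ d\theta^5&=-2\theta^5\wedge\Omega_2+\theta^4\wedge\Omega_4+\tfrac{e^{-3\phi}}{\rho^3}I^2\,\theta^1\wedge\theta^2-\tfrac{e^{\phi}}{2\rho}I^3_{|5}\,\theta^4\wedge\theta^5+Q\,\theta^1\wedge\theta^5, \end{aligned}$$ $$Q=\tfrac1{8\rho^3}\Big(2e^{\phi}\bar f\,I^3_{|5}+\rho\,(I^3_{|52}+2I^3_{|4})-4e^{-\phi}f\,I^3\Big).$$ Here $X_1,\dots,X_5$ are the first five vector fields of the frame on $\mathcal G^9$ dual to $(\theta^1,\dots,\theta^5,\Omega_1,\dots,\Omega_4)$,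 and $I^3_{|4}$, $I^3_{|5}$, $I^3_{|52}$ are the functions on $U$ obtained by restricting $X_4\tilde I$, $X_5\tilde I$, $X_2X_5\tilde I$, where $\tilde I=\frac{e^{-\phi}}{\rho}I^3$, to the section $\rho=1$, $\phi=f=\bar f=0$. (2) The adapted coframe, up to the reduced group with both signs allowed, is para-CR invariant, and $I^1,I^2,I^3$ are relative invariants. Precisely, let $(U',F',H')$ be another such system, with data $\omega_0'$, $\omega'$, $I'^k$, and let $\Phi:U\to U'$ be a smooth map such that at each point $\Phi^*\omega_0'^{\,i}=\sum_jA^i{}_j\,\omega_0^j$ with $A$ invertible, $A^1{}_j=0$ for $j\ne1$, $A^i{}_j=0$ for $i\in\{2,3\},j\in\{4,5\}$ and for $i\in\{4,5\},j\in\{2,3\}$ (a local para-CR equivalence). Then there are smooth functions $a,b,f,g$ on $U$ with $a,b$ nowhere zero such that $\Phi^*\omega'=S_{a,b,f,g}\,\omega$, where $S_{a,b,f,g}$ is the matrix $$\begin{pmatrix}ab&0&0&0&0\\ f&a&0&0&0\\ \frac{f^2}{2ab}&\frac fb&\frac ab&0&0\\ g&0&0&b&0\\ -\frac{g^2}{2ab}&0&0&-\frac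 ga&\frac ba\end{pmatrix}$$ (which is $S$ for $a=\rho e^{\phi}$, $b=\rho e^{-\phi}$, $g=\bar f$), and $$I'^1\circ\Phi=b^{-3}I^1,\qquad I'^2\circ\Phi=a^{-3}I^2,\qquad I'^3\circ\Phi=a^{-1}I^3.$$ -/

import Mathlib

open scoped ContDiff

noncomputable section

namespace ParaCR

/-! ### One-forms on a normed space -/

section Forms

variable {E : Type*} [NormedAddCommGroup E] [NormedSpace ℝ E]

/-- The exterior derivative of a one-form `α`, as the expression `(v, w) ↦ dα(v, w)`; this is
Mathlib's `extDeriv`, with `α` read as a field of alternating forms in one argument. -/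
def dForm (α : E → E →L[ℝ] ℝ) (q : E) : E → E → ℝ := fun v w =>
  extDeriv (fun y => ContinuousAlternatingMap.ofSubsingleton ℝ E ℝ (0 : Fin 1) (α y)) q ![v, w]

/-- The wedge product of two covectors, `(α ∧ β)(v, w) = α(v) β(w) - α(w) β(v)`. -/
def wedge (α β : E →L[ℝ] ℝ) : E → E → ℝ := fun v w => α v * β w - α w * β v

/-- `dα(v, w) = (D_v α)(w) - (D_w α)(v)`. -/
theorem dForm_apply {α : E → E →L[ℝ] ℝ} {q : E} (h : DifferentiableAt ℝ α q) (v w : E) :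
    dForm α q v w = fderiv ℝ α q v w - fderiv ℝ α q w v := by
  have h1 : DifferentiableAt ℝ
      (fun y => ContinuousAlternatingMap.ofSubsingleton ℝ E ℝ (0 : Fin 1) (α y)) q :=
    (ContinuousAlternatingMap.ofSubsingletonLIE (𝕜 := ℝ) (E := E) (F := ℝ)
      (0 : Fin 1)).toContinuousLinearEquiv.differentiable.differentiableAt.comp q h
  have h2 : ∀ u t : E, fderiv ℝ (fun y => α y u) q t = fderiv ℝ α q t u := by
    intro u t
    rw [fderiv_clm_apply h (differentiableAt_const u)]
    simp
  rw [dForm, extDeriv_apply h1]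
  simp [Fin.sum_univ_two, Fin.removeNth_apply, h2, sub_eq_add_neg]

end Forms

/-! ### The jet space and the system `z_y = F`, `z_xxx = H` -/

/-- The space of second jets, with coordinates `(x, y, z, p, r)`. -/
abbrev Jet := Fin 5 → ℝ

/-- The partial derivative with respect to the `i`-th coordinate of `(x, y, z, p, r)`. -/
def pd (i : Fin 5) (g : Jet → ℝ) : Jet → ℝ := fun m => fderiv ℝ g m (Pi.single i 1)

/-- `D = ∂_x + p ∂_z + r ∂_p + H ∂_r`. -/
def opD (H g : Jet → ℝ) : Jet → ℝ := fun m =>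
  pd 0 g m + m 3 * pd 2 g m + m 4 * pd 3 g m + H m * pd 4 g m

/-- `Δ = ∂_y + F ∂_z + (D F) ∂_p + (D² F) ∂_r`. -/
def opDelta (F H g : Jet → ℝ) : Jet → ℝ := fun m =>
  pd 1 g m + F m * pd 2 g m + opD H F m * pd 3 g m + opD H (opD H F) m * pd 4 g m

/-- The standing assumptions: on the open set `U` of the jet space, `F` and `H` are smooth,
`F_r = 0`, `F_pp` vanishes nowhere, and `D³ F = Δ H`. -/
structure IsSystem (U : Set Jet) (F H : Jet → ℝ) : Prop where
  isOpen : IsOpen U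
  smooth_F : ContDiffOn ℝ ∞ F U
  smooth_H : ContDiffOn ℝ ∞ H U
  F_r : ∀ m ∈ U, pd 4 F m = 0
  F_pp : ∀ m ∈ U, pd 3 (pd 3 F) m ≠ 0
  integrable : ∀ m ∈ U, opD H (opD H (opD H F)) m = opDelta F H H m

/-- The coordinate differentials `dx, dy, dz, dp, dr`. -/
def dcoord (i : Fin 5) : Jet →L[ℝ] ℝ := ContinuousLinearMap.proj i

/-- The initial coframe
`dz - p dx - F dy`, `dp - r dx - DF dy`, `dr - H dx - D²F dy`, `dx`, `dy`. -/
def omega0 (F H : Jet → ℝ) (i : Fin 5) (m : Jet) : Jet →L[ℝ] ℝ :=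
  ![dcoord 2 - m 3 • dcoord 0 - F m • dcoord 1,
    dcoord 3 - m 4 • dcoord 0 - opD H F m • dcoord 1,
    dcoord 4 - H m • dcoord 0 - opD H (opD H F) m • dcoord 1,
    dcoord 0,
    dcoord 1] i

/-- The matrix that carries the initial coframe to the adapted one. -/
def adaptMatrix (F H : Jet → ℝ) (m : Jet) : Matrix (Fin 5) (Fin 5) ℝ :=
  let Fp := pd 3 F m
  let Fpp := pd 3 (pd 3 F) m
  let Fppp := pd 3 (pd 3 (pd 3 F)) m
  let Fpppp := pd 3 (pd 3 (pd 3 (pd 3 F))) m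
  let Hr := pd 4 H m
  let Hp := pd 3 H m
  let DHr := opD H (pd 4 H) m
  !![-1, 0, 0, 0, 0;
     0, 1, 0, 0, 0;
     (2 * Hr ^ 2 + 9 * Hp - 3 * DHr) / 18, Hr / 3, -1, 0, 0;
     0, 0, 0, 1, Fp;
     (3 * Fpp * Fpppp - 5 * Fppp ^ 2) / (18 * Fpp ^ 2), 0, 0,
       Fppp / (3 * Fpp), (Fppp * Fp - 3 * Fpp ^ 2) / (3 * Fpp)]

/-- The adapted coframe `ω¹, …, ω⁵` on the base. -/
def omega (F H : Jet → ℝ) (i : Fin 5) (m : Jet) : Jet →L[ℝ] ℝ :=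
  ∑ j, adaptMatrix F H m i j • omega0 F H j m

/-- The relative invariant `I¹`. -/
def I1 (H : Jet → ℝ) (m : Jet) : ℝ :=
  let Hr := pd 4 H m
  let Hp := pd 3 H m
  let Hz := pd 2 H m
  let DHr := opD H (pd 4 H) m
  let D2Hr := opD H (opD H (pd 4 H)) m
  let DHp := opD H (pd 3 H) m
  (-1 / 54) * (9 * D2Hr - 27 * DHp - 18 * DHr * Hr + 18 * Hp * Hr + 4 * Hr ^ 3 + 54 * Hz)

/-- The relative invariant `I²`. -/
def I2 (F : Jet → ℝ) (m : Jet) : ℝ :=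
  let Fpp := pd 3 (pd 3 F) m
  let Fppp := pd 3 (pd 3 (pd 3 F)) m
  let Fpppp := pd 3 (pd 3 (pd 3 (pd 3 F))) m
  let Fppppp := pd 3 (pd 3 (pd 3 (pd 3 (pd 3 F)))) m
  (40 * Fppp ^ 3 - 45 * Fpp * Fppp * Fpppp + 9 * Fpp ^ 2 * Fppppp) / (54 * Fpp ^ 3)

/-- The relative invariant `I³`. -/
def I3 (F H : Jet → ℝ) (m : Jet) : ℝ :=
  let Fpp := pd 3 (pd 3 F) m
  let Fppp := pd 3 (pd 3 (pd 3 F)) m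
  let Hrr := pd 4 (pd 4 H) m
  (2 * Fppp + Fpp * Hrr) / (3 * Fpp)

/-! ### The nine-dimensional bundle -/

/-- The ambient space of the bundle: a jet `m` and fibre coordinates `s = (ρ, φ, f, g)`, where
`f` and `g` stand for `f²` and `f̄²`. -/
abbrev Bundle := Jet × (Fin 4 → ℝ)

/-- The bundle over `U`: the fibre coordinate `ρ` is positive, the three others are free. -/
def bundleOver (U : Set Jet) : Set Bundle := {q | q.1 ∈ U ∧ 0 < q.2 0}

/-- The matrix of the reduced structure group, in the parameters `a = ρ e^φ`, `b = ρ e^(-φ)`, `f`,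
`g`; thus `a b = ρ²`, `a / b = e^(2φ)`, `f / b = f e^φ / ρ` and `g / a = g e^(-φ) / ρ`. -/
def groupMatrix (a b f g : ℝ) : Matrix (Fin 5) (Fin 5) ℝ :=
  !![a * b, 0, 0, 0, 0;
     f, a, 0, 0, 0;
     f ^ 2 / (2 * (a * b)), f / b, a / b, 0, 0;
     g, 0, 0, b, 0;
     -(g ^ 2 / (2 * (a * b))), 0, 0, -(g / a), b / a]

/-- The lifted coframe `θ¹, …, θ⁵`, that is, `θ = S · ω`. -/
def theta (F H : Jet → ℝ) (i : Fin 5) (q : Bundle) : Bundle →L[ℝ] ℝ :=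
  ∑ j, groupMatrix (q.2 0 * Real.exp (q.2 1)) (q.2 0 * Real.exp (-q.2 1)) (q.2 2) (q.2 3) i j •
    (omega F H j q.1).comp (ContinuousLinearMap.fst ℝ Jet (Fin 4 → ℝ))

/-- Written out in `ρ, φ, f, g`, the group matrix is the one in the definition of `θ`. -/
theorem groupMatrix_exp {ρ : ℝ} (hρ : 0 < ρ) (φ f g : ℝ) :
    groupMatrix (ρ * Real.exp φ) (ρ * Real.exp (-φ)) f g =
      !![ρ ^ 2, 0, 0, 0, 0;
         f, ρ * Real.exp φ, 0, 0, 0;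
         f ^ 2 / (2 * ρ ^ 2), f * Real.exp φ / ρ, Real.exp (2 * φ), 0, 0;
         g, 0, 0, ρ * Real.exp (-φ), 0;
         -(g ^ 2) / (2 * ρ ^ 2), 0, 0, -(g * Real.exp (-φ)) / ρ, Real.exp (-(2 * φ))] := by
  have h0 : ρ ≠ 0 := hρ.ne'
  have h1 : Real.exp φ ≠ 0 := (Real.exp_pos φ).ne'
  have h2 : Real.exp (2 * φ) = Real.exp φ * Real.exp φ := by rw [two_mul, Real.exp_add]
  have h3 : ρ * Real.exp φ * (ρ * (Real.exp φ)⁻¹) = ρ ^ 2 := by field_simp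
  ext i j
  fin_cases i <;> fin_cases j <;>
    simp [groupMatrix, Real.exp_neg, h2, h3] <;> field_simp

/-- The vector fields `X 0, …, X 4` on the bundle over `U` are the first five members of the frame
dual to the coframe `θ¹, …, θ⁵, Ω₁, …, Ω₄`. -/
def IsDualFrame (U : Set Jet) (F H : Jet → ℝ) (Ω : Fin 4 → Bundle → Bundle →L[ℝ] ℝ)
    (X : Fin 5 → Bundle → Bundle) : Prop :=
  ∀ q ∈ bundleOver U, ∀ j,
    (∀ i, theta F H i q (X j q) = if i = j then 1 else 0) ∧ ∀ a, Ω a q (X j q) = 0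

/-- The derivative of a function on the bundle along a vector field. -/
def lieD (X : Bundle → Bundle) (u : Bundle → ℝ) : Bundle → ℝ := fun q => fderiv ℝ u q (X q)

/-- `I³` as a function on the bundle, with its weight: `(e^(-φ) / ρ) I³`. -/
def I3lift (F H : Jet → ℝ) : Bundle → ℝ := fun q =>
  Real.exp (-q.2 1) / q.2 0 * I3 F H q.1

/-- The section `ρ = 1`, `φ = f = g = 0`, along which `θ` is `ω`. -/
def unitSection (m : Jet) : Bundle := (m, ![1, 0, 0, 0])

/-- `I³_{|4}`, as a function on the base. -/
def I3_4 (F H : Jet → ℝ) (X : Fin 5 → Bundle → Bundle) (m : Jet) : ℝ :=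
  lieD (X 3) (I3lift F H) (unitSection m)

/-- `I³_{|5}`, as a function on the base. -/
def I3_5 (F H : Jet → ℝ) (X : Fin 5 → Bundle → Bundle) (m : Jet) : ℝ :=
  lieD (X 4) (I3lift F H) (unitSection m)

/-- `I³_{|52} = (I³_{|5})_{|2}`, as a function on the base. -/
def I3_52 (F H : Jet → ℝ) (X : Fin 5 → Bundle → Bundle) (m : Jet) : ℝ :=
  lieD (X 1) (lieD (X 4) (I3lift F H)) (unitSection m)

/-- The coefficient at `θ¹ ∧ θ³` in `dθ³` and at `θ¹ ∧ θ⁵` in `dθ⁵`. -/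
def coeffQ (F H : Jet → ℝ) (X : Fin 5 → Bundle → Bundle) (q : Bundle) : ℝ :=
  let ρ := q.2 0
  let φ := q.2 1
  let f := q.2 2
  let g := q.2 3
  1 / (8 * ρ ^ 3) * (2 * Real.exp φ * g * I3_5 F H X q.1 +
    ρ * (I3_52 F H X q.1 + 2 * I3_4 F H X q.1) - 4 * Real.exp (-φ) * f * I3 F H q.1)

/-- The structure equations at the point `q` of the bundle. -/
def StructureEquations (F H : Jet → ℝ) (Ω : Fin 4 → Bundle → Bundle →L[ℝ] ℝ)
    (X : Fin 5 → Bundle → Bundle) (q : Bundle) : Prop :=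
  let ρ := q.2 0
  let φ := q.2 1
  let θ₁ := theta F H 0 q
  let θ₂ := theta F H 1 q
  let θ₃ := theta F H 2 q
  let θ₄ := theta F H 3 q
  let θ₅ := theta F H 4 q
  let Ω₁ := Ω 0 q
  let Ω₂ := Ω 1 q
  let Ω₃ := Ω 2 q
  let Ω₄ := Ω 3 q
  (dForm (theta F H 0) q = -wedge θ₁ Ω₁ + wedge θ₂ θ₄) ∧
  (dForm (theta F H 1) q =
    wedge θ₂ (Ω₂ - (1 / 2 : ℝ) • Ω₁) - wedge θ₁ Ω₃ + wedge θ₃ θ₄) ∧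
  (dForm (theta F H 2) q =
    (2 : ℝ) • wedge θ₃ Ω₂ - wedge θ₂ Ω₃
      + (Real.exp (3 * φ) / ρ ^ 3 * I1 H q.1) • wedge θ₁ θ₄
      + (Real.exp (-φ) / ρ * I3 F H q.1) • wedge θ₂ θ₃
      + coeffQ F H X q • wedge θ₁ θ₃) ∧
  (dForm (theta F H 3) q =
    -wedge θ₂ θ₅ - wedge θ₄ ((1 / 2 : ℝ) • Ω₁ + Ω₂) - wedge θ₁ Ω₄) ∧
  (dForm (theta F H 4) q =
    -((2 : ℝ) • wedge θ₅ Ω₂) + wedge θ₄ Ω₄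
      + (Real.exp (-(3 * φ)) / ρ ^ 3 * I2 F q.1) • wedge θ₁ θ₂
      - (Real.exp φ / (2 * ρ) * I3_5 F H X q.1) • wedge θ₄ θ₅
      + coeffQ F H X q • wedge θ₁ θ₅)

/-! ### Para-CR equivalences -/

/-- The block shape of a change of representative of a para-CR structure of type `(1, 2, 2)`. -/
def IsParaCRChange (A : Matrix (Fin 5) (Fin 5) ℝ) : Prop :=
  A.det ≠ 0 ∧ (∀ j, j ≠ 0 → A 0 j = 0) ∧
    A 1 3 = 0 ∧ A 1 4 = 0 ∧ A 2 3 = 0 ∧ A 2 4 = 0 ∧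
    A 3 1 = 0 ∧ A 3 2 = 0 ∧ A 4 1 = 0 ∧ A 4 2 = 0

/-- `Φ` is a local para-CR equivalence from the structure of `(F, H)` on `U` to that of
`(F', H')` on `U'`: it is smooth and pulls the initial coframe of the latter back to a
representative of the class of the initial coframe of the former. (As the matrix of the change is
invertible, `Φ` is then a local diffeomorphism.) -/
structure IsParaCREquivalence (U : Set Jet) (F H : Jet → ℝ) (U' : Set Jet) (F' H' : Jet → ℝ)
    (Φ : Jet → Jet) : Prop where
  smooth : ContDiffOn ℝ ∞ Φ U
  mapsTo : Set.MapsTo Φ U U'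
  pullback : ∀ m ∈ U, ∃ A : Matrix (Fin 5) (Fin 5) ℝ, IsParaCRChange A ∧
    ∀ i, (omega0 F' H' i (Φ m)).comp (fderiv ℝ Φ m) = ∑ j, A i j • omega0 F H j m

end ParaCR

end

noncomputable section

namespace ParaCR

/-! ### Exterior calculus of one-forms. -/

section Forms

variable {E : Type*} [NormedAddCommGroup E] [NormedSpace ℝ E]

/-! This is Cartan's method of equivalence with the answer given in advance: the structure equations
are verified for one coframe, transported by the reduced group, and shown to be rigid enough to
determine the coframe up to that group.

The base. The condition D³F = ΔH says exactly that D and Δ commute (`JetRing.D_Δ`). Put K = Δ − F_p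
D. The frame ∂_z, ∂_p, ∂_r, D, K has dual coframe κ, and dκ is governed by the commutators of the
frame (`dForm_kappa`). The adapted coframe ω is a combination of κ with coefficients built from H_r,
N, C, M and F_pp, so dω involves the derivatives of these along the frame. Differentiating K H = D³F
− F_p DH by ∂_r and ∂_p gives K of H_r, H_rr and H_p, and from there K N and K M. What does not
cancel is the torsion: I¹ (Wünschmann's expression) is left over from D N, I² (Monge's) from ∂_p M,
and I³ comes from 2C + H_rr. The outcome is `cartanEqs_base`. The identities are proved in an
abstract differential algebra `JetRing`, where they are polynomial, and then evaluated at points of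
U.

The group. By `CartanEqs.lift` the shape of the equations survives a change of coframe by S, with
explicit laws for connection and torsion. When the group parameters are the fibre coordinates, this
gives the equations on the bundle; the new connection forms contain the Maurer–Cartan forms of the
group, hence complete θ to a coframe. Differentiating the lift of I³ along the dual frame identifies
the remaining coefficients with I³_{|5} and Q.

Equivalences. Since d commutes with pull-back, Φ*ω' obeys equations of the same shape. Comparing
dθ¹, dθ² and dθ⁴ with the block form of the change fixes its diagonal blocks (`CartanEqs.diagonal`,
`CartanEqs.diagonal'`). Reading the same connection value from two different equations removes the
other surplus entries (`CartanEqs.compare_first`, `CartanEqs.compare_second`), so Φ*ω' = S ω.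
Finally I¹, I², I³ are determined by the coframe alone (`CartanEqs.torsion_unique`), and their
weights are those in `CartanEqs.lift`. -/

theorem dForm_congr {α β : E → E →L[ℝ] ℝ} {q : E} (h : α =ᶠ[nhds q] β) :
    dForm α q = dForm β q := by
  have h1 : (fun y => ContinuousAlternatingMap.ofSubsingleton ℝ E ℝ (0 : Fin 1) (α y)) =ᶠ[nhds q]
      fun y => ContinuousAlternatingMap.ofSubsingleton ℝ E ℝ (0 : Fin 1) (β y) :=
    h.mono fun y hy => by simp only [hy]
  funext v w
  simp only [dForm, h1.extDeriv_eq]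

/-- The Leibniz rule for the exterior derivative of a combination of one-forms. -/
theorem dForm_sum_smul {n : ℕ} {c : Fin n → E → ℝ} {c' : Fin n → E →L[ℝ] ℝ}
    {α : Fin n → E → E →L[ℝ] ℝ} {q : E}
    (hc : ∀ j, HasFDerivAt (c j) (c' j) q) (hα : ∀ j, DifferentiableAt ℝ (α j) q) (v w : E) :
    dForm (fun y => ∑ j, c j y • α j y) q v w =
      ∑ j, (wedge (c' j) (α j q) v w + c j q * dForm (α j) q v w) := by
  have h1 : HasFDerivAt (fun y => ∑ j, c j y • α j y)
      (∑ j, (c j q • fderiv ℝ (α j) q + (c' j).smulRight (α j q))) q :=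
    HasFDerivAt.fun_sum fun j _ => (hc j).smul (hα j).hasFDerivAt
  rw [dForm_apply h1.differentiableAt, h1.fderiv]
  simp only [sum_apply, add_apply,
    smul_apply, ContinuousLinearMap.smulRight_apply, smul_eq_mul,
    ← Finset.sum_sub_distrib]
  refine Finset.sum_congr rfl fun j _ => ?_
  rw [dForm_apply (hα j), wedge]
  ring

/-- The exterior derivative commutes with pull-back. -/
theorem dForm_pullback {E' : Type*} [NormedAddCommGroup E'] [NormedSpace ℝ E']
    {α : E → E →L[ℝ] ℝ} {Φ : E' → E} {q : E'}
    (hα : DifferentiableAt ℝ α (Φ q)) (hΦ : ContDiffAt ℝ ∞ Φ q) (v w : E') :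
    dForm (fun y => (α (Φ y)).comp (fderiv ℝ Φ y)) q v w =
      dForm α (Φ q) (fderiv ℝ Φ q v) (fderiv ℝ Φ q w) := by
  have hd : DifferentiableAt ℝ Φ q := hΦ.differentiableAt (by simp)
  have hd' : DifferentiableAt ℝ (fderiv ℝ Φ) q :=
    (hΦ.fderiv_right (m := 1) (by norm_cast)).differentiableAt (by simp)
  have hαΦ : HasFDerivAt (fun y => α (Φ y)) ((fderiv ℝ α (Φ q)).comp (fderiv ℝ Φ q)) q :=
    hα.hasFDerivAt.comp q hd.hasFDerivAt
  have h1 := hαΦ.clm_comp hd'.hasFDerivAt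
  have hs : IsSymmSndFDerivAt ℝ Φ q := hΦ.isSymmSndFDerivAt (by simp; norm_cast)
  rw [dForm_apply h1.differentiableAt, h1.fderiv, dForm_apply hα]
  simp [hs.eq v w]

end Forms

/-! ### Structure equations, abstractly -/

section Cartan

variable {E : Type*} [NormedAddCommGroup E] [NormedSpace ℝ E]

/-- The structure equations of an adapted coframe `t` with exterior derivative `dt`, connection
forms `O`, and torsion coefficients `i₁`, `i₂`, `i₃`, `j`, `c`. -/
def CartanEqs (dt : Fin 5 → E → E → ℝ) (t : Fin 5 → E →L[ℝ] ℝ) (O : Fin 4 → E →L[ℝ] ℝ)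
    (i₁ i₂ i₃ j c : ℝ) : Prop := ∀ v w,
  dt 0 v w = -wedge (t 0) (O 0) v w + wedge (t 1) (t 3) v w ∧
  dt 1 v w = wedge (t 1) (O 1) v w - 1 / 2 * wedge (t 1) (O 0) v w - wedge (t 0) (O 2) v w
    + wedge (t 2) (t 3) v w ∧
  dt 2 v w = 2 * wedge (t 2) (O 1) v w - wedge (t 1) (O 2) v w + i₁ * wedge (t 0) (t 3) v w
    + i₃ * wedge (t 1) (t 2) v w + c * wedge (t 0) (t 2) v w ∧
  dt 3 v w = -wedge (t 1) (t 4) v w - 1 / 2 * wedge (t 3) (O 0) v w - wedge (t 3) (O 1) v w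
    - wedge (t 0) (O 3) v w ∧
  dt 4 v w = -(2 * wedge (t 4) (O 1) v w) + wedge (t 3) (O 3) v w + i₂ * wedge (t 0) (t 1) v w
    - j / 2 * wedge (t 3) (t 4) v w + c * wedge (t 0) (t 4) v w

/-- The differential of `groupMatrix a b f g`, in terms of those of `a`, `b`, `f`, `g`. -/
def groupMatrixD (a b f g : ℝ) (da db df dg : E →L[ℝ] ℝ) : Matrix (Fin 5) (Fin 5) (E →L[ℝ] ℝ) :=
  !![b • da + a • db, 0, 0, 0, 0;
     df, da, 0, 0, 0;
     (f / (a * b)) • df - (f ^ 2 / (2 * a ^ 2 * b)) • da - (f ^ 2 / (2 * a * b ^ 2)) • db,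
       (1 / b) • df - (f / b ^ 2) • db, (1 / b) • da - (a / b ^ 2) • db, 0, 0;
     dg, 0, 0, db, 0;
     (g ^ 2 / (2 * a ^ 2 * b)) • da + (g ^ 2 / (2 * a * b ^ 2)) • db - (g / (a * b)) • dg, 0, 0,
       (g / a ^ 2) • da - (1 / a) • dg, (1 / a) • db - (b / a ^ 2) • da]

theorem hasFDerivAt_groupMatrix {a b f g : E → ℝ} {da db df dg : E →L[ℝ] ℝ} {q : E}
    (ha : HasFDerivAt a da q) (hb : HasFDerivAt b db q) (hf : HasFDerivAt f df q)
    (hg : HasFDerivAt g dg q) (ha0 : a q ≠ 0) (hb0 : b q ≠ 0) (i l : Fin 5) :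
    HasFDerivAt (fun y => groupMatrix (a y) (b y) (f y) (g y) i l)
      (groupMatrixD (a q) (b q) (f q) (g q) da db df dg i l) q := by
  have hdiv : ∀ {u k : E → ℝ} {u' k' : E →L[ℝ] ℝ}, HasFDerivAt u u' q → HasFDerivAt k k' q →
      k q ≠ 0 → HasFDerivAt (fun y => u y / k y)
        ((1 / k q) • u' - (u q / k q ^ 2) • k') q := by
    intro u k u' k' hu hk h0
    have h1 := hu.mul ((hasDerivAt_inv h0).comp_hasFDerivAt q hk)
    refine (h1.congr_of_eventuallyEq (Filter.Eventually.of_forall fun y => ?_)).congr_fderiv ?_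
    · simp [div_eq_mul_inv]
    · ext v
      simp
      field_simp
      ring
  have hab := (ha.mul hb).const_mul 2
  have h2 : (2 : ℝ) * (a q * b q) ≠ 0 := mul_ne_zero two_ne_zero (mul_ne_zero ha0 hb0)
  have h0 : HasFDerivAt (fun _ : E => (0 : ℝ)) (0 : E →L[ℝ] ℝ) q := hasFDerivAt_const 0 q
  have hab1 : HasFDerivAt (fun y => a y * b y) (b q • da + a q • db) q :=
    (ha.mul hb).congr_fderiv (add_comm _ _)
  have hf2 : HasFDerivAt (fun y => f y ^ 2 / (2 * (a y * b y)))
      ((f q / (a q * b q)) • df - (f q ^ 2 / (2 * a q ^ 2 * b q)) • da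
        - (f q ^ 2 / (2 * a q * b q ^ 2)) • db) q := by
    refine (hdiv (hf.pow 2) hab h2).congr_fderiv ?_
    ext v
    simp
    field_simp
    ring
  have hg2 : HasFDerivAt (fun y => -(g y ^ 2 / (2 * (a y * b y))))
      ((g q ^ 2 / (2 * a q ^ 2 * b q)) • da + (g q ^ 2 / (2 * a q * b q ^ 2)) • db
        - (g q / (a q * b q)) • dg) q := by
    refine (hdiv (hg.pow 2) hab h2).neg.congr_fderiv ?_
    ext v
    simp
    field_simp
    ring
  have hga : HasFDerivAt (fun y => -(g y / a y)) ((g q / a q ^ 2) • da - (1 / a q) • dg) q :=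
    (hdiv hg ha ha0).neg.congr_fderiv (by ext v; simp)
  fin_cases i <;> fin_cases l
  exacts [hab1, h0, h0, h0, h0, hf, ha, h0, h0, h0, hf2, hdiv hf hb hb0, hdiv ha hb hb0, h0, h0,
    hg, h0, h0, hb, h0, hg2, h0, h0, hga, hdiv hb ha ha0]

/-- The connection forms of the coframe `groupMatrix a b f g · t`. -/
def liftConnection (a b f g : ℝ) (da db df dg : E →L[ℝ] ℝ) (t : Fin 5 → E →L[ℝ] ℝ)
    (O : Fin 4 → E →L[ℝ] ℝ) (i₃ j c : ℝ) : Fin 4 → E →L[ℝ] ℝ :=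
  -- Adding a multiple of θ¹ to Ω₂ moves the coefficients at θ¹ ∧ θ³ and θ¹ ∧ θ⁵ in opposite
  -- directions; `x` is the multiple that makes them equal again. The terms in `x` in the last two
  -- forms compensate for it in dθ² and dθ⁴.
  let x := f * g / (2 * a * b) + i₃ * f / (4 * a) + j * g / (8 * b)
  ![O 0 + (1 / a) • da + (1 / b) • db + (f / a) • t 3 - (g / b) • t 1,
    O 1 - (1 / (2 * a)) • da + (1 / (2 * b)) • db + (f / (2 * a)) • t 3 + (g / (2 * b)) • t 1
      + x • t 0,
    (1 / b) • O 2 + (f / (2 * a * b)) • O 0 + (f / (a * b)) • O 1 + (1 / (a * b)) • df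
      - (f / (a ^ 2 * b)) • da + (f ^ 2 / (2 * a ^ 2 * b)) • t 3 - (x / b) • t 1
      - (g / b ^ 2) • t 2
      + (f ^ 2 * g / (2 * a ^ 2 * b ^ 2) - f * x / (a * b) - c * f / (a * b)
        + i₃ * f ^ 2 / (2 * a ^ 2 * b)) • t 0,
    (1 / a) • O 3 + (g / (2 * a * b)) • O 0 - (g / (a * b)) • O 1 + (1 / (a * b)) • dg
      - (g / (a * b ^ 2)) • db + (x / a) • t 3 - (f / a ^ 2) • t 4
      - (g ^ 2 / (2 * a * b ^ 2)) • t 1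
      + (g * x / (a * b) - f * g ^ 2 / (2 * a ^ 2 * b ^ 2) - c * g / (a * b)
        - j * g ^ 2 / (4 * a * b ^ 2)) • t 0]

/-- The structure equations are preserved by the reduced structure group. -/
theorem CartanEqs.lift {dt : Fin 5 → E → E → ℝ} {t : Fin 5 → E →L[ℝ] ℝ} {O : Fin 4 → E →L[ℝ] ℝ}
    {i₁ i₂ i₃ j c : ℝ} (h : CartanEqs dt t O i₁ i₂ i₃ j c) {a b : ℝ} (ha : a ≠ 0) (hb : b ≠ 0)
    (f g : ℝ) (da db df dg : E →L[ℝ] ℝ) :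
    CartanEqs
      (fun i v w => ∑ l, (wedge (groupMatrixD a b f g da db df dg i l) (t l) v w
        + groupMatrix a b f g i l * dt l v w))
      (fun i => ∑ l, groupMatrix a b f g i l • t l)
      (liftConnection a b f g da db df dg t O i₃ j c)
      (i₁ / b ^ 3) (i₂ / a ^ 3) (i₃ / a) (j / b)
      (c / (a * b) - i₃ * f / (2 * a ^ 2 * b) + j * g / (4 * a * b ^ 2)) := by
  intro v w
  obtain ⟨h0, h1, h2, h3, h4⟩ := h v w
  simp only [Fin.sum_univ_five, h0, h1, h2, h3, h4]
  simp [groupMatrix, groupMatrixD, liftConnection, wedge]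
  refine ⟨?_, ?_, ?_, ?_, ?_⟩
  · field_simp
    ring
  · field_simp
    ring
  · field_simp
    ring
  · field_simp
    ring
  · field_simp
    ring

end Cartan

/-! ### The differential algebra of a system -/

/-- A commutative algebra with five commuting derivations (for `∂_x, ∂_y, ∂_z, ∂_p, ∂_r`), the two
coordinates `p` and `r`, a system `F`, `H`, and an inverse `G` of `F_pp`. -/
structure JetRing (A : Type*) [CommRing A] [Algebra ℝ A] where
  d : Fin 5 → Derivation ℝ A A
  p : A
  r : A
  F : A
  H : A
  G : A
  D : Derivation ℝ A A
  Δ : Derivation ℝ A A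
  K : Derivation ℝ A A
  D_def : D = d 0 + p • d 2 + r • d 3 + H • d 4
  Δ_def : Δ = d 1 + F • d 2 + D F • d 3 + D (D F) • d 4
  K_def : K = Δ - d 3 F • D
  comm : ∀ i j u, d i (d j u) = d j (d i u)
  d_p : ∀ i, d i p = if i = 3 then 1 else 0
  d_r : ∀ i, d i r = if i = 4 then 1 else 0
  F_r : d 4 F = 0
  G_mul : d 3 (d 3 F) * G = 1
  integrable : D (D (D F)) = Δ H

namespace JetRing

variable {A : Type*} [CommRing A] [Algebra ℝ A] (S : JetRing A)

theorem D_apply (u : A) : S.D u = S.d 0 u + S.p * S.d 2 u + S.r * S.d 3 u + S.H * S.d 4 u := by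
  rw [S.D_def]; simp

theorem Δ_apply (u : A) : S.Δ u =
    S.d 1 u + S.F * S.d 2 u + S.D S.F * S.d 3 u + S.D (S.D S.F) * S.d 4 u := by
  rw [S.Δ_def]; simp

theorem K_apply (u : A) : S.K u = S.Δ u - S.d 3 S.F * S.D u := by
  rw [S.K_def]; simp

theorem der_ofNat (δ : Derivation ℝ A A) (n : ℕ) [n.AtLeastTwo] :
    δ (no_index (OfNat.ofNat n : A)) = 0 :=
  δ.map_natCast n

/-! ### Commutators of the derivations. -/

theorem r_D (u : A) : S.d 4 (S.D u) = S.D (S.d 4 u) + S.d 3 u + S.d 4 S.H * S.d 4 u := by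
  simp only [D_apply, map_add, Derivation.leibniz, smul_eq_mul, S.d_p, S.d_r, S.comm 4]
  simp
  ring

theorem p_D (u : A) : S.d 3 (S.D u) = S.D (S.d 3 u) + S.d 2 u + S.d 3 S.H * S.d 4 u := by
  simp only [D_apply, map_add, Derivation.leibniz, smul_eq_mul, S.d_p, S.d_r, S.comm 3]
  simp
  ring

theorem z_D (u : A) : S.d 2 (S.D u) = S.D (S.d 2 u) + S.d 2 S.H * S.d 4 u := by
  simp only [D_apply, map_add, Derivation.leibniz, smul_eq_mul, S.d_p, S.d_r, S.comm 2]
  simp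
  ring

theorem r_p (u : A) : S.d 4 (S.d 3 u) = S.d 3 (S.d 4 u) := S.comm 4 3 u

theorem r_z (u : A) : S.d 4 (S.d 2 u) = S.d 2 (S.d 4 u) := S.comm 4 2 u

theorem p_z (u : A) : S.d 3 (S.d 2 u) = S.d 2 (S.d 3 u) := S.comm 3 2 u

theorem r_DF : S.d 4 (S.D S.F) = S.d 3 S.F := by
  rw [r_D, S.F_r]; simp

/-- The commutator has components DF − Δp, D(DF) − Δr and D(D²F) − ΔH along ∂_z, ∂_p, ∂_r; the last
one vanishes by integrability. -/
theorem D_Δ (u : A) : S.D (S.Δ u) = S.Δ (S.D u) := by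
  have hi := S.integrable
  have h0 : ∀ i, S.D (S.d i u) = S.d 0 (S.d i u) + S.p * S.d 2 (S.d i u) + S.r * S.d 3 (S.d i u)
    + S.H * S.d 4 (S.d i u) := fun i => S.D_apply _
  have h1 : ∀ i, S.Δ (S.d i u) = S.d 1 (S.d i u) + S.F * S.d 2 (S.d i u)
    + S.D S.F * S.d 3 (S.d i u) + S.D (S.D S.F) * S.d 4 (S.d i u) := fun i => S.Δ_apply _
  have hp : S.Δ S.p = S.D S.F := by simp [Δ_apply, S.d_p]
  have hr : S.Δ S.r = S.D (S.D S.F) := by simp [Δ_apply, S.d_r]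
  rw [S.Δ_apply u, S.D_apply u]
  simp only [map_add, Derivation.leibniz, smul_eq_mul, hi, hp, hr]
  rw [h0, h0, h0, h0, h1, h1, h1, h1]
  simp only [S.comm 1 0, S.comm 2 0, S.comm 3 0, S.comm 4 0, S.comm 2 1, S.comm 3 1, S.comm 4 1,
    S.comm 3 2, S.comm 4 2, S.comm 4 3]
  ring

theorem r_Δ (u : A) : S.d 4 (S.Δ u) =
    S.Δ (S.d 4 u) + S.d 3 S.F * S.d 3 u + S.d 4 (S.D (S.D S.F)) * S.d 4 u := by
  simp only [Δ_apply, map_add, Derivation.leibniz, smul_eq_mul, S.comm 4, S.r_DF, S.F_r]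
  ring

theorem p_Δ (u : A) : S.d 3 (S.Δ u) =
    S.Δ (S.d 3 u) + S.d 3 S.F * S.d 2 u + S.d 3 (S.D S.F) * S.d 3 u
      + S.d 3 (S.D (S.D S.F)) * S.d 4 u := by
  simp only [Δ_apply, map_add, Derivation.leibniz, smul_eq_mul, S.comm 3]
  ring

theorem D_K (u : A) : S.D (S.K u) = S.K (S.D u) - S.D (S.d 3 S.F) * S.D u := by
  simp only [K_apply, map_sub, Derivation.leibniz, smul_eq_mul, S.D_Δ]
  ring

/-- Subtracting F_p D from Δ removes the ∂_p component of [∂_r, Δ], so that ∂_r and K close up among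
themselves. -/
theorem r_K (u : A) :
    S.d 4 (S.K u) = S.K (S.d 4 u) + (S.d 2 S.F + 2 * S.D (S.d 3 S.F)) * S.d 4 u := by
  simp only [K_apply, map_sub, map_add, Derivation.leibniz, smul_eq_mul, S.r_Δ, S.r_D, S.p_D,
    S.r_p, S.F_r, map_zero]
  ring

theorem p_K (u : A) : S.d 3 (S.K u) = S.K (S.d 3 u) - S.d 3 (S.d 3 S.F) * S.D u
    + (S.d 2 S.F + S.D (S.d 3 S.F)) * S.d 3 u
    + (2 * S.D (S.d 2 S.F) + S.D (S.D (S.d 3 S.F))) * S.d 4 u := by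
  simp only [K_apply, map_sub, map_add, Derivation.leibniz, smul_eq_mul, S.p_Δ, S.r_D, S.p_D,
    S.z_D, S.F_r, map_zero]
  ring

/-! ### Differential consequences of integrability. -/

theorem K_H : S.K S.H = S.D (S.D (S.D S.F)) - S.d 3 S.F * S.D S.H := by
  rw [K_apply, S.integrable]

/-- This is ∂_r applied to `K_H`; a second application gives `K_Hrr`. -/
theorem K_Hr : S.K (S.d 4 S.H) = 3 * S.D (S.d 2 S.F) + 3 * S.D (S.D (S.d 3 S.F))
    + S.d 4 S.H * S.D (S.d 3 S.F) := by
  have h := congrArg (S.d 4) S.K_H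
  rw [S.r_K] at h
  simp only [map_sub, map_add, Derivation.leibniz, smul_eq_mul, S.r_D, S.p_D,
    S.z_D, S.r_p, S.F_r, map_zero] at h
  linear_combination h

theorem K_Hrr : S.K (S.d 4 (S.d 4 S.H)) = 6 * S.d 2 (S.d 3 S.F) + 6 * S.D (S.d 3 (S.d 3 S.F))
    + 4 * S.d 3 (S.d 3 S.F) * S.d 4 S.H
    - (S.d 2 S.F + S.D (S.d 3 S.F)) * S.d 4 (S.d 4 S.H) := by
  have h := congrArg (S.d 4) S.K_Hr
  rw [S.r_K] at h
  simp only [map_add, Derivation.leibniz, smul_eq_mul, S.r_D, S.p_D, der_ofNat, S.r_p,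
    S.r_z, S.p_z, S.F_r, map_zero] at h
  linear_combination h

theorem K_Hp : S.K (S.d 3 S.H) = S.d 3 (S.D (S.D (S.D S.F))) - S.d 3 S.F * S.d 3 (S.D S.H)
    - (S.d 2 S.F + S.D (S.d 3 S.F)) * S.d 3 S.H
    - (2 * S.D (S.d 2 S.F) + S.D (S.D (S.d 3 S.F))) * S.d 4 S.H := by
  have h := congrArg (S.d 3) S.K_H
  rw [S.p_K] at h
  simp only [map_sub, Derivation.leibniz, smul_eq_mul] at h
  linear_combination h

/-- `18` times the entry `(2 H_r² + 9 H_p - 3 D H_r) / 18` of the adapted coframe. -/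
def N : A := 2 * S.d 4 S.H ^ 2 + 9 * S.d 3 S.H - 3 * S.D (S.d 4 S.H)

/-- `F_ppp / F_pp`. -/
def C : A := S.d 3 (S.d 3 (S.d 3 S.F)) * S.G

/-- `18` times the entry `(3 F_pp F_pppp - 5 F_ppp²) / (18 F_pp²)` of the adapted coframe. -/
def M : A := 3 * S.d 3 (S.d 3 (S.d 3 (S.d 3 S.F))) * S.G - 5 * S.C ^ 2

/-- `3 I³`. -/
def T : A := 2 * S.C + S.d 4 (S.d 4 S.H)

/-- `3 I³_{|5}`. -/
def T5 : A := -(S.G * (S.K S.T + (S.d 2 S.F + S.D (S.d 3 S.F)) * S.T))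

/-- `9 I³_{|4}`. -/
def T4 : A := 3 * S.D S.T + S.d 4 S.H * S.T - S.C * S.T5

/-- `9 I³_{|52}`. -/
def T52 : A := 3 * S.d 3 S.T5 + S.d 4 S.H * S.d 4 S.T5 + S.C * S.T5

/-- `18` times the coefficient at `ω¹ ∧ ω³` in `dω³` before the last absorption. -/
def L : A := 3 * S.D (S.d 4 (S.d 4 S.H)) - 6 * S.d 3 (S.d 4 S.H) - S.d 4 S.H * S.d 4 (S.d 4 S.H)

/-- `54 I¹`. -/
def J1 : A := -(9 * S.D (S.D (S.d 4 S.H)) - 27 * S.D (S.d 3 S.H)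
  - 18 * S.D (S.d 4 S.H) * S.d 4 S.H + 18 * S.d 3 S.H * S.d 4 S.H + 4 * S.d 4 S.H ^ 3
  + 54 * S.d 2 S.H)

/-- `54 I²`. -/
def J2 : A := 40 * S.C ^ 3 - 45 * S.C * (S.d 3 (S.d 3 (S.d 3 (S.d 3 S.F))) * S.G)
  + 9 * (S.d 3 (S.d 3 (S.d 3 (S.d 3 (S.d 3 S.F)))) * S.G)

theorem der_G (δ : Derivation ℝ A A) : δ S.G = -(S.G ^ 2 * δ (S.d 3 (S.d 3 S.F))) := by
  have h := congrArg δ S.G_mul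
  have h1 := S.G_mul
  simp only [Derivation.leibniz, smul_eq_mul, Derivation.map_one_eq_zero] at h
  linear_combination S.G * h - δ S.G * h1

/-- The weights 9 and −3 in N are such that D³F_p cancels between K H_p and K D H_r, leaving only 18
D²F_z in third order. -/
theorem K_N : S.K S.N = 2 * S.N * S.D (S.d 3 S.F) - 6 * S.d 4 S.H * S.D (S.d 2 S.F)
    + 18 * S.D (S.D (S.d 2 S.F)) := by
  have h1 : S.K (S.D (S.d 4 S.H)) = S.D (S.K (S.d 4 S.H))
      + S.D (S.d 3 S.F) * S.D (S.d 4 S.H) := by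
    linear_combination -S.D_K (S.d 4 S.H)
  simp only [N, map_sub, map_add, Derivation.leibniz, Derivation.leibniz_pow, smul_eq_mul,
    der_ofNat, h1, S.K_Hp, S.K_Hr, S.p_D, S.r_D, S.z_D, S.F_r,
    map_zero, nsmul_eq_mul]
  push_cast
  ring

theorem r_N : S.d 4 S.N = -S.L := by
  simp only [N, L, map_sub, map_add, Derivation.leibniz, Derivation.leibniz_pow, smul_eq_mul,
    der_ofNat, S.r_D, S.r_p, nsmul_eq_mul]
  push_cast
  ring

/-- I¹ enters the structure equations here, as the part of D N that no choice of connection form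
absorbs. -/
theorem D_N : 3 * S.D S.N = S.J1 - 6 * S.D (S.d 4 S.H) * S.d 4 S.H + 18 * S.d 3 S.H * S.d 4 S.H
    + 4 * S.d 4 S.H ^ 3 + 54 * S.d 2 S.H := by
  simp only [N, J1, map_sub, map_add, Derivation.leibniz, Derivation.leibniz_pow, smul_eq_mul,
    der_ofNat, nsmul_eq_mul]
  push_cast
  ring

theorem r_F2 : S.d 4 (S.d 3 (S.d 3 S.F)) = 0 := by
  simp only [S.r_p, S.F_r, map_zero]

theorem r_C : S.d 4 S.C = 0 := by
  simp only [C, Derivation.leibniz, smul_eq_mul, S.der_G, S.r_p, S.F_r, map_zero]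
  ring

theorem r_M : S.d 4 S.M = 0 := by
  simp only [M, map_sub, Derivation.leibniz, Derivation.leibniz_pow, smul_eq_mul, S.r_C,
    S.der_G, S.r_p, S.F_r, map_zero, der_ofNat, nsmul_eq_mul]
  ring

/-- A Riccati equation in p for F_ppp / F_pp, with M as source term. -/
theorem p_C : 3 * S.d 3 S.C = S.M + 2 * S.C ^ 2 := by
  simp only [M, C, Derivation.leibniz, smul_eq_mul, S.der_G]
  ring

/-- Differentiating the Riccati source once more produces I², up to a term that the connection
absorbs. -/
theorem p_M : 3 * S.d 3 S.M = S.J2 + 2 * S.C * S.M := by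
  have h := S.p_C
  simp only [M, map_sub, Derivation.leibniz, Derivation.leibniz_pow, smul_eq_mul,
    S.der_G, der_ofNat, nsmul_eq_mul]
  simp only [M, J2] at *
  push_cast
  have h2 : S.d 3 (S.d 3 (S.d 3 S.F)) * S.G = S.C := rfl
  linear_combination (-10) * S.C * h - 9 * S.d 3 (S.d 3 (S.d 3 (S.d 3 S.F))) * S.G * h2

theorem F2_C : S.d 3 (S.d 3 S.F) * S.C = S.d 3 (S.d 3 (S.d 3 S.F)) := by
  rw [C]
  linear_combination S.d 3 (S.d 3 (S.d 3 S.F)) * S.G_mul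

/-- The correction by (F_z + D F_p) T in T5 cancels the H_rr term of `K_Hrr`. Multiplying by F_pp
removes the inverse G, so the relation can be differentiated cheaply. -/
theorem F2_T5 : S.d 3 (S.d 3 S.F) * S.T5 = -(2 * S.K S.C + 6 * S.d 2 (S.d 3 S.F)
    + 6 * S.D (S.d 3 (S.d 3 S.F)) + 4 * S.d 3 (S.d 3 S.F) * S.d 4 S.H
    + 2 * (S.d 2 S.F + S.D (S.d 3 S.F)) * S.C) := by
  simp only [T5, T, map_add, Derivation.leibniz, smul_eq_mul, der_ofNat, S.K_Hrr]
  linear_combination (-(2 * S.K S.C + 6 * S.d 2 (S.d 3 S.F)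
    + 6 * S.D (S.d 3 (S.d 3 S.F)) + 4 * S.d 3 (S.d 3 S.F) * S.d 4 S.H
    + 2 * (S.d 2 S.F + S.D (S.d 3 S.F)) * S.C)) * S.G_mul

theorem r_T5 : S.d 4 S.T5 = -8 * S.C - 4 * S.d 4 (S.d 4 S.H) := by
  have h := congrArg (S.d 4) S.F2_T5
  simp only [map_neg, map_add, Derivation.leibniz, smul_eq_mul, der_ofNat, S.r_C,
    S.r_K, S.r_D, S.r_z, S.r_p, S.F_r, map_zero] at h
  have h1 := S.F2_C
  have h2 := S.G_mul
  linear_combination S.G * h + 6 * S.G * h1 - (S.d 4 S.T5 + 8 * S.C + 4 * S.d 4 (S.d 4 S.H)) * h2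

/-- K is applied to the Riccati relation `p_C` and commuted past ∂_p; the unknown ∂_p K C is then
eliminated by ∂_p of `F2_T5`. This gives the coefficient of dω⁵ that has to be balanced against L in
dω³. -/
theorem K_M : 2 * S.K S.M = -4 * S.M * (S.d 2 S.F + S.D (S.d 3 S.F))
    + 12 * S.C * S.d 2 (S.d 3 S.F) - 36 * S.d 2 (S.d 3 (S.d 3 S.F))
    - S.d 3 (S.d 3 S.F) * (S.T52 + 2 * S.T4 - 2 * S.L) := by
  have h := congrArg (S.d 3) S.F2_T5
  have hC := S.p_C
  have hKC := congrArg S.K S.p_C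
  have hDC := congrArg S.D S.F2_C
  have h1 := S.F2_C
  have h5 := S.F2_T5
  simp only [map_neg, map_add, Derivation.leibniz, Derivation.leibniz_pow, smul_eq_mul,
    der_ofNat, S.r_C, S.p_K, S.p_D, S.p_z, S.r_p, S.F_r, map_zero, nsmul_eq_mul] at h hKC hDC
  push_cast at hKC
  rw [T52, T4, L, S.r_T5]
  simp only [T, map_add, Derivation.leibniz, smul_eq_mul, der_ofNat]
  linear_combination 3 * h - 2 * hKC - 4 * (S.d 2 S.F + S.D (S.d 3 S.F)) * hC + 18 * hDC
    - 4 * S.C * h5 + (3 * S.T5 + 12 * S.d 4 S.H) * h1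

end JetRing

/-! ### Smooth functions on an open set of the jet space -/

section Smooth

variable {U : Set Jet}

theorem contDiffOn_pd (hU : IsOpen U) {g : Jet → ℝ} (hg : ContDiffOn ℝ ∞ g U) (i : Fin 5) :
    ContDiffOn ℝ ∞ (pd i g) U :=
  (hg.fderiv_of_isOpen hU (m := ∞) (by simp)).clm_apply contDiffOn_const

theorem differentiableAt_of_smooth (hU : IsOpen U) {V : Type*} [NormedAddCommGroup V]
    [NormedSpace ℝ V] {g : Jet → V} (hg : ContDiffOn ℝ ∞ g U) {m : Jet} (hm : m ∈ U) :
    DifferentiableAt ℝ g m :=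
  (hg.contDiffAt (hU.mem_nhds hm)).differentiableAt (by simp)

theorem pd_congr (hU : IsOpen U) {g k : Jet → ℝ} (h : ∀ m ∈ U, g m = k m) (i : Fin 5) :
    ∀ m ∈ U, pd i g m = pd i k m := by
  intro m hm
  have : g =ᶠ[nhds m] k := Filter.eventually_of_mem (hU.mem_nhds hm) h
  rw [pd, pd, this.fderiv_eq]

theorem pd_comm (hU : IsOpen U) {g : Jet → ℝ} (hg : ContDiffOn ℝ ∞ g U) (i j : Fin 5) :
    ∀ m ∈ U, pd i (pd j g) m = pd j (pd i g) m := by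
  intro m hm
  have hc := hg.contDiffAt (hU.mem_nhds hm)
  have h1 : DifferentiableAt ℝ (fderiv ℝ g) m :=
    (hc.fderiv_right (m := 1) (by norm_cast)).differentiableAt (by simp)
  have hs : IsSymmSndFDerivAt ℝ g m := hc.isSymmSndFDerivAt (by simp; norm_cast)
  have h2 : ∀ a b : Jet, fderiv ℝ (fun y => fderiv ℝ g y a) m b = fderiv ℝ (fderiv ℝ g) m b a := by
    intro a b
    rw [fderiv_clm_apply h1 (differentiableAt_const a)]
    simp
  change fderiv ℝ (fun y => fderiv ℝ g y _) m _ = fderiv ℝ (fun y => fderiv ℝ g y _) m _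
  rw [h2, h2, hs.eq]

/-- The algebra of smooth functions on `U`. -/
def smoothFun (U : Set Jet) : Subalgebra ℝ (U → ℝ) where
  carrier := {u | ∃ g : Jet → ℝ, ContDiffOn ℝ ∞ g U ∧ ∀ m : U, g m = u m}
  mul_mem' := by
    rintro u v ⟨g, hg, h⟩ ⟨k, hk, h'⟩
    exact ⟨g * k, hg.mul hk, fun m => by simp [h, h']⟩
  add_mem' := by
    rintro u v ⟨g, hg, h⟩ ⟨k, hk, h'⟩
    exact ⟨g + k, hg.add hk, fun m => by simp [h, h']⟩
  algebraMap_mem' c := ⟨fun _ => c, contDiffOn_const, fun _ => rfl⟩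

/-- A function on the jet space that restricts to a given smooth function on `U`. -/
def fn (u : smoothFun U) : Jet → ℝ := Classical.choose u.2

theorem contDiffOn_fn (u : smoothFun U) : ContDiffOn ℝ ∞ (fn u) U :=
  (Classical.choose_spec u.2).1

/-- The restriction of a function to `U`. -/
def res (g : Jet → ℝ) (hg : ContDiffOn ℝ ∞ g U) : smoothFun U :=
  ⟨fun m => g m, g, hg, fun _ => rfl⟩

/-- Evaluation at a point of `U`. -/
def ev (m : U) : smoothFun U →ₐ[ℝ] ℝ := (Pi.evalAlgHom ℝ (fun _ : U => ℝ) m).comp (smoothFun U).val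

theorem ev_res (m : U) (g : Jet → ℝ) (hg : ContDiffOn ℝ ∞ g U) : ev m (res g hg) = g m := rfl

theorem fn_eq (u : smoothFun U) {m : Jet} (hm : m ∈ U) : fn u m = ev ⟨m, hm⟩ u :=
  (Classical.choose_spec u.2).2 ⟨m, hm⟩

theorem smoothFun_ext {u v : smoothFun U} (h : ∀ m, ev m u = ev m v) : u = v :=
  Subtype.ext (funext h)

/-- The partial derivatives, as derivations of the algebra of smooth functions on `U`. -/
def pdU (hU : IsOpen U) (i : Fin 5) : Derivation ℝ (smoothFun U) (smoothFun U) :=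
  Derivation.mk'
    { toFun := fun u => res (pd i (fn u)) (contDiffOn_pd hU (contDiffOn_fn u) i)
      map_add' := fun u v => smoothFun_ext fun ⟨m, hm⟩ => by
        have h1 := pd_congr hU (g := fn (u + v)) (k := fn u + fn v)
          (fun m hm => by simp [fn_eq _ hm]) i m hm
        rw [map_add, ev_res, ev_res, ev_res, h1, pd, fderiv_add
          (differentiableAt_of_smooth hU (contDiffOn_fn u) hm)
          (differentiableAt_of_smooth hU (contDiffOn_fn v) hm)]
        rfl
      map_smul' := fun c u => smoothFun_ext fun ⟨m, hm⟩ => by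
        have h1 := pd_congr hU (g := fn (c • u)) (k := c • fn u)
          (fun m hm => by simp [fn_eq _ hm]) i m hm
        rw [RingHom.id_apply, map_smul, ev_res, ev_res, h1, pd, fderiv_const_smul
          (differentiableAt_of_smooth hU (contDiffOn_fn u) hm)]
        rfl }
    fun u v => smoothFun_ext fun ⟨m, hm⟩ => by
      have h1 := pd_congr hU (g := fn (u * v)) (k := fn u * fn v)
        (fun m hm => by simp [fn_eq _ hm]) i m hm
      simp only [LinearMap.coe_mk, AddHom.coe_mk, smul_eq_mul, map_add, map_mul, ev_res]
      rw [h1, pd, fderiv_mul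
        (differentiableAt_of_smooth hU (contDiffOn_fn u) hm)
        (differentiableAt_of_smooth hU (contDiffOn_fn v) hm), fn_eq u hm, fn_eq v hm]
      rfl

theorem pdU_apply (hU : IsOpen U) (i : Fin 5) (u : smoothFun U) :
    pdU hU i u = res (pd i (fn u)) (contDiffOn_pd hU (contDiffOn_fn u) i) := rfl

/-- U is open, so a partial derivative on U does not depend on the extension that `fn` chooses. -/
theorem pdU_res (hU : IsOpen U) (i : Fin 5) (g : Jet → ℝ) (hg : ContDiffOn ℝ ∞ g U) :
    pdU hU i (res g hg) = res (pd i g) (contDiffOn_pd hU hg i) :=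
  smoothFun_ext fun ⟨m, hm⟩ => pd_congr hU (fun _ hm => fn_eq _ hm) i m hm

theorem pdU_comm (hU : IsOpen U) (i j : Fin 5) (u : smoothFun U) :
    pdU hU i (pdU hU j u) = pdU hU j (pdU hU i u) := by
  rw [pdU_apply hU j u, pdU_apply hU i u, pdU_res, pdU_res]
  exact smoothFun_ext fun ⟨m, hm⟩ => pd_comm hU (contDiffOn_fn u) i j m hm

theorem contDiffOn_coord (i : Fin 5) : ContDiffOn ℝ ∞ (fun m : Jet => m i) U :=
  (contDiff_apply ℝ ℝ i).contDiffOn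

theorem pdU_coord (hU : IsOpen U) (i j : Fin 5) :
    pdU hU i (res (fun m => m j) (contDiffOn_coord j)) = if i = j then 1 else 0 := by
  rw [pdU_res]
  refine smoothFun_ext fun ⟨m, hm⟩ => ?_
  have h : fderiv ℝ (fun y : Jet => y j) m = dcoord j := (dcoord j).fderiv
  rw [ev_res, pd, h]
  by_cases hij : i = j
  · subst hij
    simp [dcoord]
  · simp [dcoord, hij, Ne.symm hij]

end Smooth

/-! ### The system as a differential algebra, and the coframe dual to ∂_z, ∂_p, ∂_r, D, K. -/

section System

variable {U : Set Jet} {F H : Jet → ℝ}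

theorem IsSystem.smooth_D (h : IsSystem U F H) {g : Jet → ℝ} (hg : ContDiffOn ℝ ∞ g U) :
    ContDiffOn ℝ ∞ (opD H g) U :=
  (((contDiffOn_pd h.isOpen hg 0).add ((contDiffOn_coord 3).mul (contDiffOn_pd h.isOpen hg 2))).add
    ((contDiffOn_coord 4).mul (contDiffOn_pd h.isOpen hg 3))).add
    (h.smooth_H.mul (contDiffOn_pd h.isOpen hg 4))

theorem IsSystem.smooth_inv (h : IsSystem U F H) :
    ContDiffOn ℝ ∞ (fun m => (pd 3 (pd 3 F) m)⁻¹) U :=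
  (contDiffOn_pd h.isOpen (contDiffOn_pd h.isOpen h.smooth_F 3) 3).inv h.F_pp

/-- The operator `D` as a derivation. -/
def IsSystem.derD (h : IsSystem U F H) : Derivation ℝ (smoothFun U) (smoothFun U) :=
  pdU h.isOpen 0 + res (U := U) (fun m => m 3) (contDiffOn_coord 3) • pdU h.isOpen 2
    + res (U := U) (fun m => m 4) (contDiffOn_coord 4) • pdU h.isOpen 3
    + res H h.smooth_H • pdU h.isOpen 4

theorem IsSystem.derD_res (h : IsSystem U F H) (g : Jet → ℝ) (hg : ContDiffOn ℝ ∞ g U) :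
    h.derD (res g hg) = res (opD H g) (h.smooth_D hg) := by
  refine smoothFun_ext fun m => ?_
  simp [derD, pdU_res, ev_res, opD]

/-- The operator `Δ` as a derivation. -/
def IsSystem.derΔ (h : IsSystem U F H) : Derivation ℝ (smoothFun U) (smoothFun U) :=
  pdU h.isOpen 1 + res F h.smooth_F • pdU h.isOpen 2
    + h.derD (res F h.smooth_F) • pdU h.isOpen 3
    + h.derD (h.derD (res F h.smooth_F)) • pdU h.isOpen 4

/-- The differential algebra of a system. -/
def IsSystem.ring (h : IsSystem U F H) : JetRing (smoothFun U) where
  d := pdU h.isOpen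
  p := res (fun m => m 3) (contDiffOn_coord 3)
  r := res (fun m => m 4) (contDiffOn_coord 4)
  F := res F h.smooth_F
  H := res H h.smooth_H
  G := res (fun m => (pd 3 (pd 3 F) m)⁻¹) h.smooth_inv
  D := h.derD
  Δ := h.derΔ
  K := h.derΔ - pdU h.isOpen 3 (res F h.smooth_F) • h.derD
  D_def := rfl
  Δ_def := rfl
  K_def := rfl
  comm := pdU_comm h.isOpen
  d_p i := pdU_coord h.isOpen i 3
  d_r i := pdU_coord h.isOpen i 4
  F_r := by
    rw [pdU_res]
    exact smoothFun_ext fun m => by rw [ev_res, h.F_r m m.2, map_zero]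
  G_mul := by
    rw [pdU_res, pdU_res]
    refine smoothFun_ext fun m => ?_
    rw [map_mul, ev_res, ev_res, map_one, mul_inv_cancel₀ (h.F_pp m m.2)]
  integrable := by
    refine smoothFun_ext fun m => ?_
    simp only [h.derD_res, ev_res, h.integrable m m.2, derΔ, opDelta]
    simp [pdU_res, ev_res]

theorem IsSystem.ring_F (h : IsSystem U F H) : h.ring.F = res F h.smooth_F := rfl

theorem IsSystem.ring_H (h : IsSystem U F H) : h.ring.H = res H h.smooth_H := rfl

theorem IsSystem.ring_D (h : IsSystem U F H) (g : Jet → ℝ) (hg : ContDiffOn ℝ ∞ g U) :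
    h.ring.D (res g hg) = res (opD H g) (h.smooth_D hg) := h.derD_res g hg

theorem IsSystem.ring_d (h : IsSystem U F H) (i : Fin 5) (g : Jet → ℝ)
    (hg : ContDiffOn ℝ ∞ g U) :
    h.ring.d i (res g hg) = res (pd i g) (contDiffOn_pd h.isOpen hg i) := pdU_res h.isOpen i g hg

theorem IsSystem.ev_G (h : IsSystem U F H) (m : U) :
    ev m h.ring.G = (pd 3 (pd 3 F) m)⁻¹ := rfl

/-- The coframe dual to the frame `∂_z, ∂_p, ∂_r, D, Δ - F_p D`. -/
def kappa (F H : Jet → ℝ) (i : Fin 5) (m : Jet) : Jet →L[ℝ] ℝ :=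
  ![dcoord 2 - m 3 • dcoord 0 - F m • dcoord 1,
    dcoord 3 - m 4 • dcoord 0 - opD H F m • dcoord 1,
    dcoord 4 - H m • dcoord 0 - opD H (opD H F) m • dcoord 1,
    dcoord 0 + pd 3 F m • dcoord 1,
    dcoord 1] i

/-- The differential of a smooth function, in terms of the coframe `kappa`. -/
def dFun (h : IsSystem U F H) (u : smoothFun U) (m : Jet) : Jet →L[ℝ] ℝ :=
  fn (h.ring.d 2 u) m • kappa F H 0 m + fn (h.ring.d 3 u) m • kappa F H 1 m
    + fn (h.ring.d 4 u) m • kappa F H 2 m + fn (h.ring.D u) m • kappa F H 3 m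
    + fn (h.ring.K u) m • kappa F H 4 m

theorem fderiv_apply_eq_sum (g : Jet → ℝ) (m v : Jet) :
    fderiv ℝ g m v = ∑ i, v i * pd i g m := by
  conv_lhs => rw [pi_eq_sum_univ' v]
  simp only [map_sum, map_smul, smul_eq_mul, pd]

/-- This is the duality of `kappa` with the frame ∂_z, ∂_p, ∂_r, D, K, in the form in which it is
used: du = Σ (eᵢ u) κⁱ. -/
theorem hasFDerivAt_fn (h : IsSystem U F H) (u : smoothFun U) {m : Jet} (hm : m ∈ U) :
    HasFDerivAt (fn u) (dFun h u m) m := by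
  refine (differentiableAt_of_smooth h.isOpen (contDiffOn_fn u) hm).hasFDerivAt.congr_fderiv ?_
  ext v
  have hd : ∀ i, ev ⟨m, hm⟩ (h.ring.d i u) = pd i (fn u) m := fun i => rfl
  have hp : ev ⟨m, hm⟩ h.ring.p = m 3 := rfl
  have hr : ev ⟨m, hm⟩ h.ring.r = m 4 := rfl
  have hK := h.ring.K_apply u
  rw [fderiv_apply_eq_sum]
  simp only [dFun, fn_eq _ hm, hK, h.ring.Δ_apply, h.ring.D_apply u, map_add, map_sub, map_mul, hd,
    hp, hr]
  simp [h.ring_F, h.ring_H, h.ring_D, h.ring_d, ev_res, kappa, dcoord, Fin.sum_univ_five]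
  ring

theorem hasFDerivAt_of_eq_fn (h : IsSystem U F H) {g : Jet → ℝ} (u : smoothFun U)
    (hg : ∀ m ∈ U, g m = fn u m) {m : Jet} (hm : m ∈ U) : HasFDerivAt g (dFun h u m) m :=
  (hasFDerivAt_fn h u hm).congr_of_eventuallyEq
    (Filter.eventually_of_mem (h.isOpen.mem_nhds hm) hg)

theorem contDiffOn_kappa (h : IsSystem U F H) (i : Fin 5) : ContDiffOn ℝ ∞ (kappa F H i) U := by
  have hc : ∀ {g : Jet → ℝ}, ContDiffOn ℝ ∞ g U → ∀ i,
      ContDiffOn ℝ ∞ (fun m => g m • dcoord i) U := fun hg i => hg.smul contDiffOn_const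
  have hF := h.smooth_F
  have hDF := h.smooth_D hF
  have hD2F := h.smooth_D hDF
  fin_cases i
  · exact (contDiffOn_const.sub (hc (contDiffOn_coord 3) 0)).sub (hc hF 1)
  · exact (contDiffOn_const.sub (hc (contDiffOn_coord 4) 0)).sub (hc hDF 1)
  · exact (contDiffOn_const.sub (hc h.smooth_H 0)).sub (hc hD2F 1)
  · exact contDiffOn_const.add (hc (contDiffOn_pd h.isOpen hF 3) 1)
  · exact contDiffOn_const

/-- The coefficients are minus those of the commutators of the dual frame, since dκ(X, Y) = −κ([X,
Y]) on dual vectors. Integrability, through `K_H`, is what keeps κ₃ ∧ κ₄ out of dκ₂. -/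
theorem dForm_kappa (h : IsSystem U F H) {m : Jet} (hm : m ∈ U) (v w : Jet) :
    let e := ev ⟨m, hm⟩
    let R := h.ring
    let k := fun i j => wedge (kappa F H i m) (kappa F H j m) v w
    dForm (kappa F H 0) m v w = -k 1 3 - e (R.d 2 R.F) * k 0 4 ∧
    dForm (kappa F H 1) m v w = -k 2 3 - e (R.D (R.d 2 R.F)) * k 0 4
      - e (R.d 2 R.F + R.D (R.d 3 R.F)) * k 1 4 ∧
    dForm (kappa F H 2) m v w = -e (R.d 2 R.H) * k 0 3 - e (R.d 3 R.H) * k 1 3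
      - e (R.d 4 R.H) * k 2 3 - e (R.D (R.D (R.d 2 R.F))) * k 0 4
      - e (2 * R.D (R.d 2 R.F) + R.D (R.D (R.d 3 R.F))) * k 1 4
      - e (R.d 2 R.F + 2 * R.D (R.d 3 R.F)) * k 2 4 ∧
    dForm (kappa F H 3) m v w = e (R.d 2 (R.d 3 R.F)) * k 0 4 + e (R.d 3 (R.d 3 R.F)) * k 1 4
      + e (R.D (R.d 3 R.F)) * k 3 4 ∧
    dForm (kappa F H 4) m v w = 0 := by
  intro e R k
  have hgen : ∀ (j : Fin 5) {g₁ g₂ : Jet → ℝ} {g₁' g₂' : Jet →L[ℝ] ℝ}, HasFDerivAt g₁ g₁' m →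
      HasFDerivAt g₂ g₂' m →
      dForm (fun y => dcoord j - g₁ y • dcoord 0 - g₂ y • dcoord 1) m v w =
        -(g₁' v * w 0 - g₁' w * v 0) - (g₂' v * w 1 - g₂' w * v 1) := by
    intro j g₁ g₂ g₁' g₂' h1 h2
    have h3 := ((hasFDerivAt_const (dcoord j) m).sub (h1.smul_const (dcoord 0))).sub
      (h2.smul_const (dcoord 1))
    have h4 : HasFDerivAt (fun y => dcoord j - g₁ y • dcoord 0 - g₂ y • dcoord 1) _ m := h3
    rw [dForm_apply h4.differentiableAt, h4.fderiv]
    simp [dcoord]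
    ring
  have hcoord : ∀ i : Fin 5, HasFDerivAt (fun y : Jet => y i) (dcoord i) m :=
    fun i => (dcoord i).hasFDerivAt
  have hF := hasFDerivAt_of_eq_fn h (g := F) R.F (fun m hm => by rw [fn_eq _ hm]; rfl) hm
  have hH := hasFDerivAt_of_eq_fn h (g := H) R.H (fun m hm => by rw [fn_eq _ hm]; rfl) hm
  have hDF := hasFDerivAt_of_eq_fn h (g := opD H F) (R.D R.F)
    (fun m hm => by rw [fn_eq _ hm, h.ring_F, h.ring_D, ev_res]) hm
  have hD2F := hasFDerivAt_of_eq_fn h (g := opD H (opD H F)) (R.D (R.D R.F))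
    (fun m hm => by rw [fn_eq _ hm, h.ring_F, h.ring_D, h.ring_D, ev_res]) hm
  have hFp := hasFDerivAt_of_eq_fn h (g := pd 3 F) (R.d 3 R.F)
    (fun m hm => by rw [fn_eq _ hm, h.ring_F, h.ring_d, ev_res]) hm
  have e1 : e (R.D R.F) = opD H F m := by
    simp only [R, e, h.ring_F, h.ring_D, ev_res]
  have e2 : e (R.D (R.D R.F)) = opD H (opD H F) m := by
    simp only [R, e, h.ring_F, h.ring_D, ev_res]
  have e3 : e (R.d 3 R.F) = pd 3 F m := by
    simp only [R, e, h.ring_F, h.ring_d, ev_res]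
  have e4 : e R.H = H m := rfl
  have r1 := R.r_DF
  have r2 : R.d 4 (R.D (R.D R.F)) = R.d 2 R.F + 2 * R.D (R.d 3 R.F) + R.d 4 R.H * R.d 3 R.F := by
    rw [R.r_D, R.r_DF, R.p_D, R.F_r]
    ring
  have r3 : R.d 3 (R.D R.F) = R.D (R.d 3 R.F) + R.d 2 R.F := by
    rw [R.p_D, R.F_r]
    ring
  have r4 : R.d 3 (R.D (R.D R.F)) = R.D (R.D (R.d 3 R.F)) + 2 * R.D (R.d 2 R.F)
      + R.d 3 R.H * R.d 3 R.F := by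
    rw [R.p_D, R.z_D, r3, R.r_DF, R.F_r, map_add]
    ring
  have r5 : R.d 2 (R.D R.F) = R.D (R.d 2 R.F) := by
    rw [R.z_D, R.F_r]
    ring
  have r6 : R.d 2 (R.D (R.D R.F)) = R.D (R.D (R.d 2 R.F)) + R.d 2 R.H * R.d 3 R.F := by
    rw [R.z_D, r5, R.r_DF]
  have r7 : R.d 4 (R.d 3 R.F) = 0 := by rw [R.r_p, R.F_r, map_zero]
  have r8 := R.K_H
  have r9 : R.K (R.D R.F) = R.D (R.K R.F) + R.D (R.d 3 R.F) * R.D R.F := by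
    rw [R.D_K]
    ring
  refine ⟨?_, ?_, ?_, ?_, ?_⟩
  · rw [show kappa F H 0 = fun y => dcoord 2 - y 3 • dcoord 0 - F y • dcoord 1 from rfl,
      hgen 2 (hcoord 3) hF]
    simp only [dFun, fn_eq _ hm, k]
    simp [wedge, kappa, dcoord, R.F_r, R, e, ← e1, ← e2, ← e3, ← e4]
    ring
  · rw [show kappa F H 1 = fun y => dcoord 3 - y 4 • dcoord 0 - opD H F y • dcoord 1 from rfl,
      hgen 3 (hcoord 4) hDF]
    simp only [dFun, fn_eq _ hm, k]
    simp [wedge, kappa, dcoord, R, e, ← e1, ← e2, ← e3, ← e4, r1, r3, r5]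
    ring
  · rw [show kappa F H 2 = fun y => dcoord 4 - H y • dcoord 0 - opD H (opD H F) y • dcoord 1
      from rfl, hgen 4 hH hD2F]
    simp only [dFun, fn_eq _ hm, k]
    simp [wedge, kappa, dcoord, R, e, ← e1, ← e2, ← e3, ← e4, r2, r4, r6, r8]
    ring
  · have h4 : HasFDerivAt (kappa F H 3) ((dFun h (R.d 3 R.F) m).smulRight (dcoord 1)) m := by
      exact (hFp.smul_const (dcoord 1)).const_add (dcoord 0)
    rw [dForm_apply h4.differentiableAt, h4.fderiv]
    simp only [dFun, fn_eq _ hm, k]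
    simp [wedge, kappa, dcoord, R, e, r7]
    ring
  · have h4 : HasFDerivAt (𝕜 := ℝ) (kappa F H 4) 0 m := hasFDerivAt_const (dcoord 1) m
    rw [dForm_apply h4.differentiableAt, h4.fderiv]
    simp

end System

/-! ### The structure equations on the base -/

section Base

variable {U : Set Jet} {F H : Jet → ℝ}

theorem ev_ofNat (m : U) (n : ℕ) [n.AtLeastTwo] :
    ev m (no_index (OfNat.ofNat n)) = OfNat.ofNat n := map_natCast (ev m) n

/-- The adapted coframe in terms of `kappa`. -/
def adapted (h : IsSystem U F H) : Matrix (Fin 5) (Fin 5) (smoothFun U) :=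
  let R := h.ring
  !![-1, 0, 0, 0, 0;
     0, 1, 0, 0, 0;
     (1 / 18 : ℝ) • R.N, (1 / 3 : ℝ) • R.d 4 R.H, -1, 0, 0;
     0, 0, 0, 1, 0;
     (1 / 18 : ℝ) • R.M, 0, 0, (1 / 3 : ℝ) • R.C, -R.d 3 (R.d 3 R.F)]

theorem omega_eq (h : IsSystem U F H) (i : Fin 5) {m : Jet} (hm : m ∈ U) :
    omega F H i m = ∑ j, fn (adapted h i j) m • kappa F H j m := by
  have h0 := h.F_pp m hm
  ext v
  simp only [fn_eq _ hm]
  fin_cases i <;>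
    simp [omega, adaptMatrix, omega0, kappa, adapted, Fin.sum_univ_five, JetRing.N, JetRing.M,
      JetRing.C, h.ring_F, h.ring_H, h.ring_d, h.ring_D, ev_res, h.ev_G, ev_ofNat] <;>
    field_simp <;> ring

/-- The coefficients of the connection forms of the adapted coframe in terms of `kappa`. -/
def connMatrix (h : IsSystem U F H) : Matrix (Fin 4) (Fin 5) (smoothFun U) :=
  let R := h.ring
  -- Before the last absorption the coefficients at ω¹ ∧ ω³ and ω¹ ∧ ω⁵ are L/18 and (T52 + 2 T4 − 2
  -- L)/36. Their mean is `q`, the torsion Q; a quarter of their difference is `x`, which Ω₂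
  -- absorbs. The entry is −x because ω¹ = −κ₀.
  let x : smoothFun U := (1 / 144 : ℝ) • (R.T52 + 2 * R.T4 - 4 * R.L)
  let q : smoothFun U := (1 / 72 : ℝ) • (R.T52 + 2 * R.T4)
  !![0, 0, 0, 0, R.d 2 R.F;
     -x, (1 / 3 : ℝ) • R.C, 0, -((1 / 3 : ℝ) • R.d 4 R.H),
       -((1 / 2 : ℝ) • R.d 2 R.F + R.D (R.d 3 R.F));
     -((1 / 18 : ℝ) • R.d 3 R.N) + (1 / 3 : ℝ) • R.d 2 (R.d 4 R.H) - (1 / 27 : ℝ) • (R.N * R.C)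
       + (1 / 3 : ℝ) • ((q - 2 * x) * R.d 4 R.H) + (1 / 54 : ℝ) • (R.N * R.T),
       -x, 0, -((1 / 18 : ℝ) • R.N), -R.D (R.d 2 R.F);
     (1 / 18 : ℝ) • R.D R.M - (1 / 3 : ℝ) • R.d 2 R.C + (1 / 27 : ℝ) • (R.M * R.d 4 R.H)
       - (1 / 3 : ℝ) • ((q + 2 * x) * R.C) + (1 / 108 : ℝ) • (R.T5 * R.M),
       -((1 / 18 : ℝ) • R.M), 0, x, R.d 2 (R.d 3 R.F)]

/-- The connection forms of the adapted coframe. -/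
def conn (h : IsSystem U F H) (a : Fin 4) (m : Jet) : Jet →L[ℝ] ℝ :=
  ∑ j, fn (connMatrix h a j) m • kappa F H j m

/-- The function `I³_{|5}`. -/
def torsJ (h : IsSystem U F H) : smoothFun U := (1 / 3 : ℝ) • h.ring.T5

/-- The value of `Q` on the unit section. -/
def torsQ (h : IsSystem U F H) : smoothFun U := (1 / 72 : ℝ) • (h.ring.T52 + 2 * h.ring.T4)

theorem I1_eq (h : IsSystem U F H) {m : Jet} (hm : m ∈ U) :
    I1 H m = 1 / 54 * ev ⟨m, hm⟩ h.ring.J1 := by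
  simp [I1, JetRing.J1, h.ring_H, h.ring_d, h.ring_D, ev_res, ev_ofNat]
  ring

theorem I2_eq (h : IsSystem U F H) {m : Jet} (hm : m ∈ U) :
    I2 F m = 1 / 54 * ev ⟨m, hm⟩ h.ring.J2 := by
  have h0 := h.F_pp m hm
  simp [I2, JetRing.J2, JetRing.C, h.ring_F, h.ring_d, ev_res, h.ev_G, ev_ofNat]
  field_simp

theorem I3_eq (h : IsSystem U F H) {m : Jet} (hm : m ∈ U) :
    I3 F H m = 1 / 3 * ev ⟨m, hm⟩ h.ring.T := by
  have h0 := h.F_pp m hm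
  simp [I3, JetRing.T, JetRing.C, h.ring_F, h.ring_H, h.ring_d, ev_res, h.ev_G, ev_ofNat]
  field_simp

-- Everything is expanded in κ. The equations for dω¹, dω² and dω⁴ then hold by the choice of the
-- connection forms; those for dω³ and dω⁵ carry the torsion and need the identities for N on one
-- side and for C, M, T5 on the other.
set_option maxHeartbeats 2000000 in
theorem cartanEqs_base (h : IsSystem U F H) {m : Jet} (hm : m ∈ U) :
    CartanEqs (fun i => dForm (omega F H i) m) (fun i => omega F H i m) (fun a => conn h a m)
      (I1 H m) (I2 F m) (I3 F H m) (fn (torsJ h) m) (fn (torsQ h) m) := by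
  intro v w
  have hω : ∀ i, dForm (omega F H i) m v w =
      ∑ j, (wedge (dFun h (adapted h i j) m) (kappa F H j m) v w
        + fn (adapted h i j) m * dForm (kappa F H j) m v w) := by
    intro i
    have h1 : omega F H i =ᶠ[nhds m] fun y => ∑ j, fn (adapted h i j) y • kappa F H j y :=
      Filter.eventually_of_mem (h.isOpen.mem_nhds hm) fun y hy => omega_eq h i hy
    rw [dForm_congr h1]
    exact dForm_sum_smul (fun j => hasFDerivAt_fn h _ hm)
      (fun j => differentiableAt_of_smooth h.isOpen (contDiffOn_kappa h j) hm) v w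
  obtain ⟨k0, k1, k2, k3, k4⟩ := dForm_kappa h hm v w
  simp only [hω, omega_eq h _ hm, conn, torsJ, torsQ, I1_eq h hm, I2_eq h hm, I3_eq h hm,
    Fin.sum_univ_five, k0, k1, k2, k3, k4, dFun, fn_eq _ hm]
  clear k0 k1 k2 k3 k4 hω
  set R := h.ring with hR
  have eKN := congrArg (ev ⟨m, hm⟩) R.K_N
  have erN := congrArg (ev ⟨m, hm⟩) R.r_N
  have eDN := congrArg (ev ⟨m, hm⟩) R.D_N
  have eKHr := congrArg (ev ⟨m, hm⟩) R.K_Hr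
  have eN := congrArg (ev ⟨m, hm⟩)
    (show R.N = 2 * R.d 4 R.H ^ 2 + 9 * R.d 3 R.H - 3 * R.D (R.d 4 R.H) from rfl)
  have eT := congrArg (ev ⟨m, hm⟩) (show R.T = 2 * R.C + R.d 4 (R.d 4 R.H) from rfl)
  have erF2 := congrArg (ev ⟨m, hm⟩) R.r_F2
  have erC := congrArg (ev ⟨m, hm⟩) R.r_C
  have erM := congrArg (ev ⟨m, hm⟩) R.r_M
  have epC := congrArg (ev ⟨m, hm⟩) R.p_C
  have epM := congrArg (ev ⟨m, hm⟩) R.p_M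
  have eKM := congrArg (ev ⟨m, hm⟩) R.K_M
  have eF2C := congrArg (ev ⟨m, hm⟩) R.F2_C
  have eF2T5 := congrArg (ev ⟨m, hm⟩) R.F2_T5
  simp only [map_add, map_sub, map_mul, map_neg, map_pow, ev_ofNat] at eKN erN eDN eKHr
  simp only [map_add, map_sub, map_mul, map_pow, map_zero, ev_ofNat] at eN eT erF2 erC
  simp only [map_add, map_sub, map_mul, map_neg, map_pow, map_zero, ev_ofNat] at erM epC epM eKM
  simp only [map_add, map_mul, map_neg, ev_ofNat] at eF2C eF2T5
  simp only [adapted, connMatrix, ← hR]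
  simp [wedge, ev_ofNat]
  -- From here the values of κ on the two vectors are free variables, so each equation is an
  -- identity between two-forms in κ.
  generalize kappa F H 0 m v = a0
  generalize kappa F H 1 m v = a1
  generalize kappa F H 2 m v = a2
  generalize kappa F H 3 m v = a3
  generalize kappa F H 4 m v = a4
  generalize kappa F H 0 m w = b0
  generalize kappa F H 1 m w = b1
  generalize kappa F H 2 m w = b2
  generalize kappa F H 3 m w = b3
  generalize kappa F H 4 m w = b4
  refine ⟨?_, ?_, ?_, ?_, ?_⟩
  · ring
  · ring
  -- Each multiplier is a minor, the value of some κᵢ ∧ κⱼ, so this compares coefficients: `eDN` at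
  -- κ₀ ∧ κ₃ accounts for I¹ and `eT` at κ₁ ∧ κ₂ for I³. In the last equation `epM` at κ₀ ∧ κ₁
  -- accounts for I².
  · linear_combination (-1 / 18) * (a0 * b2 - a2 * b0) * erN - 1 / 54 * (a0 * b3 - a3 * b0) * eDN
      - 1 / 18 * (a0 * b4 - a4 * b0) * eKN - 1 / 3 * (a1 * b4 - a4 * b1) * eKHr
      - 1 / 9 * (a1 * b3 - a3 * b1) * eN
      + 1 / 27 * ev ⟨m, hm⟩ (R.d 4 R.H) * (a0 * b3 - a3 * b0) * eN + 1 / 3 * (a1 * b2 - a2 * b1) * eT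
  · ring
  · linear_combination (-1 / 54) * (a0 * b1 - a1 * b0) * epM - 1 / 36 * (a0 * b4 - a4 * b0) * eKM
      + 1 / 9 * (a1 * b3 - a3 * b1) * epC - 1 / 6 * (a3 * b4 - a4 * b3) * eF2T5
      + (a1 * b4 - a4 * b1) * eF2C - 1 / 18 * (a0 * b2 - a2 * b0) * erM
      + 1 / 3 * (a2 * b3 - a3 * b2) * erC - (a2 * b4 - a4 * b2) * erF2

end Base

/-! ### The bundle -/

section Lifting

variable {U : Set Jet} {F H : Jet → ℝ}

/-- Needed for the projection of the bundle and for the differential of an equivalence. -/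
theorem CartanEqs.comp {E E' : Type*} [NormedAddCommGroup E] [NormedSpace ℝ E]
    [NormedAddCommGroup E'] [NormedSpace ℝ E'] {dt : Fin 5 → E → E → ℝ} {t : Fin 5 → E →L[ℝ] ℝ}
    {O : Fin 4 → E →L[ℝ] ℝ} {i₁ i₂ i₃ j c : ℝ} (h : CartanEqs dt t O i₁ i₂ i₃ j c)
    (L : E' →L[ℝ] E) :
    CartanEqs (fun i v w => dt i (L v) (L w)) (fun i => (t i).comp L) (fun a => (O a).comp L)
      i₁ i₂ i₃ j c :=
  fun v w => h (L v) (L w)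

theorem contDiffOn_omega (h : IsSystem U F H) (i : Fin 5) : ContDiffOn ℝ ∞ (omega F H i) U := by
  have h1 : ContDiffOn ℝ ∞ (fun m => ∑ j, fn (adapted h i j) m • kappa F H j m) U :=
    ContDiffOn.sum fun j _ => (contDiffOn_fn _).smul (contDiffOn_kappa h j)
  exact h1.congr fun m hm => omega_eq h i hm

theorem contDiffOn_conn (h : IsSystem U F H) (a : Fin 4) : ContDiffOn ℝ ∞ (conn h a) U :=
  ContDiffOn.sum fun j _ => (contDiffOn_fn _).smul (contDiffOn_kappa h j)

/-- The function `3⁻¹ T`, which is `I³` on `U`. -/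
def torsI (h : IsSystem U F H) : smoothFun U := (1 / 3 : ℝ) • h.ring.T

theorem I3_eq_fn (h : IsSystem U F H) {m : Jet} (hm : m ∈ U) : I3 F H m = fn (torsI h) m := by
  rw [I3_eq h hm, fn_eq _ hm, torsI, map_smul, smul_eq_mul]

/-- The differential of the `i`-th fibre coordinate of the bundle. -/
def fib (i : Fin 4) : Bundle →L[ℝ] ℝ :=
  (ContinuousLinearMap.proj i).comp (ContinuousLinearMap.snd ℝ Jet (Fin 4 → ℝ))

theorem hasFDerivAt_fib (i : Fin 4) (q : Bundle) :
    HasFDerivAt (fun q : Bundle => q.2 i) (fib i) q := (fib i).hasFDerivAt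

/-- The group parameters `a = ρ e^φ` and `b = ρ e^(-φ)`, for `s = 1` and `s = -1`. -/
def groupParam (s : ℝ) (q : Bundle) : ℝ := q.2 0 * Real.exp (s * q.2 1)

/-- The differential of `groupParam s`. -/
def groupParamD (s : ℝ) (q : Bundle) : Bundle →L[ℝ] ℝ :=
  Real.exp (s * q.2 1) • fib 0 + (s * (q.2 0 * Real.exp (s * q.2 1))) • fib 1

theorem groupParamD_apply (s : ℝ) (q v : Bundle) : groupParamD s q v =
    Real.exp (s * q.2 1) * v.2 0 + s * (q.2 0 * Real.exp (s * q.2 1)) * v.2 1 := by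
  simp [groupParamD, fib]

theorem hasFDerivAt_groupParam (s : ℝ) (q : Bundle) :
    HasFDerivAt (groupParam s) (groupParamD s q) q := by
  refine ((hasFDerivAt_fib 0 q).mul ((hasFDerivAt_fib 1 q).const_mul s).exp).congr_fderiv ?_
  ext <;> simp [groupParamD] <;> ring

theorem groupParam_ne_zero (s : ℝ) {q : Bundle} (hq : q ∈ bundleOver U) : groupParam s q ≠ 0 :=
  mul_ne_zero hq.2.ne' (Real.exp_ne_zero _)

/-- The adapted coframe, pulled back to the bundle. -/
def omegaLift (F H : Jet → ℝ) (i : Fin 5) (q : Bundle) : Bundle →L[ℝ] ℝ :=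
  (omega F H i q.1).comp (ContinuousLinearMap.fst ℝ Jet (Fin 4 → ℝ))

/-- The connection forms on the bundle. -/
def bundleConn (h : IsSystem U F H) (a : Fin 4) (q : Bundle) : Bundle →L[ℝ] ℝ :=
  liftConnection (groupParam 1 q) (groupParam (-1) q) (q.2 2) (q.2 3)
    (groupParamD 1 q) (groupParamD (-1) q) (fib 2) (fib 3)
    (fun i => omegaLift F H i q)
    (fun a => (conn h a q.1).comp (ContinuousLinearMap.fst ℝ Jet (Fin 4 → ℝ)))
    (fn (torsI h) q.1) (fn (torsJ h) q.1) (fn (torsQ h) q.1) a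

theorem theta_eq (F H : Jet → ℝ) (i : Fin 5) :
    theta F H i = fun q => ∑ j, groupMatrix (groupParam 1 q) (groupParam (-1) q) (q.2 2) (q.2 3) i j
      • omegaLift F H j q := by
  funext q
  simp [theta, groupParam, omegaLift]

theorem dForm_omegaLift (h : IsSystem U F H) (i : Fin 5) {q : Bundle} (hq : q ∈ bundleOver U)
    (v w : Bundle) : dForm (omegaLift F H i) q v w = dForm (omega F H i) q.1 v.1 w.1 := by
  have h1 := dForm_pullback (α := omega F H i) (Φ := (Prod.fst : Bundle → Jet)) (q := q)
    (differentiableAt_of_smooth h.isOpen (contDiffOn_omega h i) hq.1) contDiff_fst.contDiffAt v w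
  have h2 : ∀ y : Bundle, fderiv ℝ (Prod.fst : Bundle → Jet) y = ContinuousLinearMap.fst ℝ _ _ :=
    fun y => fderiv_fst
  simp only [h2] at h1
  exact h1

theorem isOpen_bundleOver (hU : IsOpen U) : IsOpen (bundleOver U) := by
  have h1 : Continuous fun q : Bundle => q.2 0 := (fib 0).continuous
  exact (hU.preimage continuous_fst).inter (isOpen_lt continuous_const h1)

theorem contDiffOn_comp_fst {V : Type*} [NormedAddCommGroup V] [NormedSpace ℝ V] {k : Jet → V}
    (hk : ContDiffOn ℝ ∞ k U) : ContDiffOn ℝ ∞ (fun q : Bundle => k q.1) (bundleOver U) :=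
  hk.comp contDiff_fst.contDiffOn fun _ hq => hq.1

theorem contDiffOn_omegaLift (h : IsSystem U F H) (i : Fin 5) :
    ContDiffOn ℝ ∞ (omegaLift F H i) (bundleOver U) :=
  (contDiffOn_comp_fst (contDiffOn_omega h i)).clm_comp contDiffOn_const

/-- The base equations are pulled back by the projection and moved by the group, with the fibre
coordinates as group parameters. -/
theorem cartanEqs_theta (h : IsSystem U F H) {q : Bundle} (hq : q ∈ bundleOver U) :
    CartanEqs (fun i => dForm (theta F H i) q) (fun i => theta F H i q) (fun a => bundleConn h a q)
      (I1 H q.1 / groupParam (-1) q ^ 3) (I2 F q.1 / groupParam 1 q ^ 3)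
      (I3 F H q.1 / groupParam 1 q) (fn (torsJ h) q.1 / groupParam (-1) q)
      (fn (torsQ h) q.1 / (groupParam 1 q * groupParam (-1) q)
        - I3 F H q.1 * q.2 2 / (2 * groupParam 1 q ^ 2 * groupParam (-1) q)
        + fn (torsJ h) q.1 * q.2 3 / (4 * groupParam 1 q * groupParam (-1) q ^ 2)) := by
  have ha := groupParam_ne_zero 1 hq
  have hb := groupParam_ne_zero (-1) hq
  have h1 := ((cartanEqs_base h hq.1).comp (ContinuousLinearMap.fst ℝ Jet (Fin 4 → ℝ))).lift ha hb
    (q.2 2) (q.2 3) (groupParamD 1 q) (groupParamD (-1) q) (fib 2) (fib 3)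
  rw [I3_eq_fn h hq.1] at h1 ⊢
  have h2 : (fun i => dForm (theta F H i) q) = fun i v w => ∑ l, (wedge
      (groupMatrixD (groupParam 1 q) (groupParam (-1) q) (q.2 2) (q.2 3) (groupParamD 1 q)
        (groupParamD (-1) q) (fib 2) (fib 3) i l) (omegaLift F H l q) v w
      + groupMatrix (groupParam 1 q) (groupParam (-1) q) (q.2 2) (q.2 3) i l
        * dForm (omega F H l) q.1 v.1 w.1) := by
    funext i v w
    rw [theta_eq, dForm_sum_smul (fun l => hasFDerivAt_groupMatrix (hasFDerivAt_groupParam 1 q)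
      (hasFDerivAt_groupParam (-1) q) (hasFDerivAt_fib 2 q) (hasFDerivAt_fib 3 q) ha hb i l)
      (fun l => ((contDiffOn_omegaLift h l).contDiffAt
        ((isOpen_bundleOver h.isOpen).mem_nhds hq)).differentiableAt (by simp))]
    simp only [dForm_omegaLift h _ hq]
  rw [h2]
  simp only [theta_eq]
  exact h1

theorem contDiffOn_liftConnection {E : Type*} [NormedAddCommGroup E] [NormedSpace ℝ E] {s : Set E}
    {a b f g i₃ j c : E → ℝ} {da db df dg : E → E →L[ℝ] ℝ} {t : Fin 5 → E → E →L[ℝ] ℝ}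
    {O : Fin 4 → E → E →L[ℝ] ℝ} (ha : ContDiffOn ℝ ∞ a s) (hb : ContDiffOn ℝ ∞ b s)
    (hf : ContDiffOn ℝ ∞ f s) (hg : ContDiffOn ℝ ∞ g s) (hi : ContDiffOn ℝ ∞ i₃ s)
    (hj : ContDiffOn ℝ ∞ j s) (hc : ContDiffOn ℝ ∞ c s) (hda : ContDiffOn ℝ ∞ da s)
    (hdb : ContDiffOn ℝ ∞ db s) (hdf : ContDiffOn ℝ ∞ df s) (hdg : ContDiffOn ℝ ∞ dg s)
    (ht : ∀ i, ContDiffOn ℝ ∞ (t i) s) (hO : ∀ i, ContDiffOn ℝ ∞ (O i) s)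
    (ha0 : ∀ q ∈ s, a q ≠ 0) (hb0 : ∀ q ∈ s, b q ≠ 0) (k : Fin 4) :
    ContDiffOn ℝ ∞ (fun q => liftConnection (a q) (b q) (f q) (g q) (da q) (db q) (df q) (dg q)
      (fun i => t i q) (fun i => O i q) (i₃ q) (j q) (c q) k) s := by
  have ht0 := ht 0
  have ht1 := ht 1
  have ht2 := ht 2
  have ht3 := ht 3
  have ht4 := ht 4
  have hO0 := hO 0
  have hO1 := hO 1
  have hO2 := hO 2
  have hO3 := hO 3
  fin_cases k <;> simp only [liftConnection, Fin.mk_zero, Fin.mk_one, Fin.reduceFinMk,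
    Fin.isValue, Matrix.cons_val] <;>
  fun_prop (disch := intro q hq; have := ha0 q hq; have := hb0 q hq; simp [*])

theorem contDiffOn_bundleConn (h : IsSystem U F H) (a : Fin 4) :
    ContDiffOn ℝ ∞ (bundleConn h a) (bundleOver U) := by
  have hfib : ∀ i, ContDiffOn ℝ ∞ (fun q : Bundle => q.2 i) (bundleOver U) :=
    fun i => (fib i).contDiff.contDiffOn
  have hexp : ∀ s : ℝ, ContDiffOn ℝ ∞ (fun q : Bundle => Real.exp (s * q.2 1)) (bundleOver U) :=
    fun s => (contDiffOn_const.mul (hfib 1)).exp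
  have hp : ∀ s, ContDiffOn ℝ ∞ (groupParam s) (bundleOver U) := fun s => (hfib 0).mul (hexp s)
  have hpD : ∀ s, ContDiffOn ℝ ∞ (groupParamD s) (bundleOver U) := fun s =>
    ((hexp s).smul contDiffOn_const).add
      ((contDiffOn_const.mul ((hfib 0).mul (hexp s))).smul contDiffOn_const)
  exact contDiffOn_liftConnection (hp 1) (hp (-1)) (hfib 2) (hfib 3)
    (contDiffOn_comp_fst (contDiffOn_fn _)) (contDiffOn_comp_fst (contDiffOn_fn _))
    (contDiffOn_comp_fst (contDiffOn_fn _)) (hpD 1) (hpD (-1)) contDiffOn_const contDiffOn_const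
    (contDiffOn_omegaLift h)
    (fun a => (contDiffOn_comp_fst (contDiffOn_conn h a)).clm_comp contDiffOn_const)
    (fun q hq => groupParam_ne_zero 1 hq) (fun q hq => groupParam_ne_zero (-1) hq) a

/-- The frame dual to `kappa`. -/
def kappaFrame (F H : Jet → ℝ) (i : Fin 5) (m : Jet) : Jet :=
  ![Pi.single 2 1, Pi.single 3 1, Pi.single 4 1,
    Pi.single 0 1 + m 3 • Pi.single 2 1 + m 4 • Pi.single 3 1 + H m • Pi.single 4 1,
    Pi.single 1 1 - pd 3 F m • Pi.single 0 1 + (F m - pd 3 F m * m 3) • Pi.single 2 1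
      + (opD H F m - pd 3 F m * m 4) • Pi.single 3 1
      + (opD H (opD H F) m - pd 3 F m * H m) • Pi.single 4 1] i

theorem kappa_kappaFrame (F H : Jet → ℝ) (i j : Fin 5) (m : Jet) :
    kappa F H i m (kappaFrame F H j m) = if i = j then 1 else 0 := by
  fin_cases i <;> fin_cases j <;> simp [kappa, kappaFrame, dcoord] <;> ring

/-- The frame dual to the adapted coframe. -/
def frame (h : IsSystem U F H) (j : Fin 5) (m : Jet) : Jet :=
  let R := h.ring
  let e := fun i => kappaFrame F H i m
  ![-e 0 - (1 / 18 * fn R.N m) • e 2 - (1 / 18 * fn (R.M * R.G) m) • e 4,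
    e 1 + (1 / 3 * fn (R.d 4 R.H) m) • e 2, -e 2,
    e 3 + (1 / 3 * fn (R.C * R.G) m) • e 4, -(fn R.G m) • e 4] j

theorem omega_frame (h : IsSystem U F H) (i j : Fin 5) {m : Jet} (hm : m ∈ U) :
    omega F H i m (frame h j m) = if i = j then 1 else 0 := by
  have hG : ev ⟨m, hm⟩ (h.ring.d 3 (h.ring.d 3 h.ring.F)) * ev ⟨m, hm⟩ h.ring.G = 1 := by
    rw [← map_mul, h.ring.G_mul, map_one]
  rw [omega_eq h i hm]
  fin_cases i <;> fin_cases j <;>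
    simp [Fin.sum_univ_five, frame, adapted, kappa_kappaFrame, fn_eq _ hm] <;>
    first
      | linear_combination hG
      | linear_combination 1 / 18 * ev ⟨m, hm⟩ h.ring.M * hG
      | linear_combination (-1 / 3) * ev ⟨m, hm⟩ h.ring.C * hG

theorem exists_omega_eq (h : IsSystem U F H) {m : Jet} (hm : m ∈ U) (o : Fin 5 → ℝ) :
    ∃ v, ∀ i, omega F H i m v = o i :=
  ⟨∑ j, o j • frame h j m, fun i => by simp [omega_frame h _ _ hm]⟩

/-- Splits off the Maurer–Cartan part of the group, the only part that sees the fibre directions. -/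
theorem liftConnection_eq {E : Type*} [NormedAddCommGroup E] [NormedSpace ℝ E] {a b : ℝ}
    (f g : ℝ) (da db df dg : E →L[ℝ] ℝ) (t : Fin 5 → E →L[ℝ] ℝ)
    (O : Fin 4 → E →L[ℝ] ℝ) (i₃ j c : ℝ) (k : Fin 4) (v : E) :
    liftConnection a b f g da db df dg t O i₃ j c k v =
      liftConnection a b f g 0 0 0 0 t O i₃ j c k v
        + ![da v / a + db v / b, db v / (2 * b) - da v / (2 * a),
            df v / (a * b) - f * da v / (a ^ 2 * b), dg v / (a * b) - g * db v / (a * b ^ 2)] k := by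
  fin_cases k <;> simp [liftConnection] <;> ring

theorem liftConnection_comp {E E' : Type*} [NormedAddCommGroup E] [NormedSpace ℝ E]
    [NormedAddCommGroup E'] [NormedSpace ℝ E'] (a b f g : ℝ) (t : Fin 5 → E →L[ℝ] ℝ)
    (O : Fin 4 → E →L[ℝ] ℝ) (i₃ j c : ℝ) (k : Fin 4) (L : E' →L[ℝ] E) (v : E') :
    liftConnection a b f g 0 0 0 0 (fun i => (t i).comp L) (fun i => (O i).comp L) i₃ j c k v =
      liftConnection a b f g 0 0 0 0 t O i₃ j c k (L v) := by
  fin_cases k <;> simp [liftConnection]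

/-- The matrix is lower triangular, so forward substitution solves the system. -/
theorem exists_groupMatrix_mulVec_eq {a b : ℝ} (ha : a ≠ 0) (hb : b ≠ 0) (f g : ℝ)
    (c : Fin 5 → ℝ) : ∃ o : Fin 5 → ℝ, ∀ i, ∑ j, groupMatrix a b f g i j * o j = c i := by
  refine ⟨![c 0 / (a * b), (c 1 - f * (c 0 / (a * b))) / a,
    (c 2 - f ^ 2 / (2 * (a * b)) * (c 0 / (a * b))
      - f / b * ((c 1 - f * (c 0 / (a * b))) / a)) * (b / a),
    (c 3 - g * (c 0 / (a * b))) / b,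
    (c 4 + g ^ 2 / (2 * (a * b)) * (c 0 / (a * b))
      + g / a * ((c 3 - g * (c 0 / (a * b))) / b)) * (a / b)], fun i => ?_⟩
  fin_cases i <;> simp [groupMatrix, Fin.sum_univ_five] <;> field_simp <;> ring

/-- The coframe `θ¹, …, θ⁵, Ω₁, …, Ω₄` takes every tuple of values. -/
theorem exists_theta_eq (h : IsSystem U F H) {q : Bundle} (hq : q ∈ bundleOver U) (c : Fin 5 → ℝ)
    (d : Fin 4 → ℝ) :
    ∃ v, (∀ i, theta F H i q v = c i) ∧ ∀ k, bundleConn h k q v = d k := by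
  have ha := groupParam_ne_zero 1 hq
  have hb := groupParam_ne_zero (-1) hq
  have hρ : q.2 0 ≠ 0 := hq.2.ne'
  have ha' : groupParam 1 q = q.2 0 * Real.exp (1 * q.2 1) := rfl
  have hb' : groupParam (-1) q = q.2 0 * Real.exp (-1 * q.2 1) := rfl
  set a := groupParam 1 q with haq
  set b := groupParam (-1) q with hbq
  obtain ⟨o, ho⟩ := exists_groupMatrix_mulVec_eq ha hb (q.2 2) (q.2 3) c
  obtain ⟨V, hV⟩ := exists_omega_eq h hq.1 o
  obtain ⟨B, hB⟩ : ∃ B : Fin 4 → ℝ, ∀ k, liftConnection a b (q.2 2) (q.2 3) 0 0 0 0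
    (fun i => omega F H i q.1) (fun k => conn h k q.1) (fn (torsI h) q.1) (fn (torsJ h) q.1)
    (fn (torsQ h) q.1) k V = B k := ⟨_, fun _ => rfl⟩
  -- The values of θ fix the base component V. The fibre components then solve the Maurer–Cartan
  -- part, with da/a = dρ/ρ + dφ and db/b = dρ/ρ − dφ: the first two connection forms give dρ and
  -- dφ, the last two give df and dg.
  refine ⟨(V, ![q.2 0 / 2 * (d 0 - B 0), B 1 - d 1,
    a * b * (d 2 - B 2) + q.2 2 * ((d 0 - B 0) / 2 + (B 1 - d 1)),
    a * b * (d 3 - B 3) + q.2 3 * ((d 0 - B 0) / 2 - (B 1 - d 1))]), fun i => ?_, fun k => ?_⟩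
  · rw [theta_eq, ← ho i]
    simp [omegaLift, hV, ← haq, ← hbq]
  · have h1 : bundleConn h k q = liftConnection a b (q.2 2) (q.2 3) (groupParamD 1 q)
        (groupParamD (-1) q) (fib 2) (fib 3) (fun i => (omega F H i q.1).comp
          (ContinuousLinearMap.fst ℝ Jet (Fin 4 → ℝ)))
        (fun a => (conn h a q.1).comp (ContinuousLinearMap.fst ℝ Jet (Fin 4 → ℝ)))
        (fn (torsI h) q.1) (fn (torsJ h) q.1) (fn (torsQ h) q.1) k := rfl
    rw [h1, liftConnection_eq, liftConnection_comp, ContinuousLinearMap.coe_fst', hB]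
    have hda : ∀ v : Bundle, groupParamD 1 q v = a / q.2 0 * v.2 0 + a * v.2 1 := fun v => by
      rw [ha', groupParamD_apply]
      field_simp
    have hdb : ∀ v : Bundle, groupParamD (-1) q v = b / q.2 0 * v.2 0 - b * v.2 1 := fun v => by
      rw [hb', groupParamD_apply]
      field_simp
      ring
    rw [hda, hdb]
    fin_cases k <;> simp [fib] <;> field_simp <;> ring

/-- Covectors that jointly take every tuple of values satisfy no linear relation. -/
theorem linearIndependent_coframe (h : IsSystem U F H) {q : Bundle} (hq : q ∈ bundleOver U) :
    LinearIndependent ℝ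
      (Sum.elim (fun i : Fin 5 => theta F H i q) (fun a : Fin 4 => bundleConn h a q)) := by
  rw [Fintype.linearIndependent_iff]
  intro x hx
  have key : ∀ (c : Fin 5 → ℝ) (d : Fin 4 → ℝ),
      ∑ i, x (Sum.inl i) * c i + ∑ k, x (Sum.inr k) * d k = 0 := by
    intro c d
    obtain ⟨v, hc, hd⟩ := exists_theta_eq h hq c d
    have h1 := congrArg (fun l : Bundle →L[ℝ] ℝ => l v) hx
    simpa [Fintype.sum_sum_type, hc, hd] using h1
  rintro (i | k)
  · simpa [Pi.single_apply] using key (Pi.single i 1) 0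
  · simpa [Pi.single_apply] using key 0 (Pi.single k 1)

/-- A function on the bundle of weight `s`. -/
def weighted (s : ℝ) (u : smoothFun U) (q : Bundle) : ℝ :=
  Real.exp (s * q.2 1) / q.2 0 * fn u q.1

theorem fderiv_weighted (h : IsSystem U F H) (s : ℝ) (u : smoothFun U) {q : Bundle}
    (hq : q ∈ bundleOver U) (v : Bundle) :
    fderiv ℝ (weighted s u) q v = Real.exp (s * q.2 1) / q.2 0 *
      (dFun h u q.1 v.1 + fn u q.1 * (s * v.2 1 - v.2 0 / q.2 0)) := by
  have hρ : q.2 0 ≠ 0 := hq.2.ne'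
  have h1 : HasFDerivAt (fun q : Bundle => fn u q.1)
      ((dFun h u q.1).comp (ContinuousLinearMap.fst ℝ Jet (Fin 4 → ℝ))) q :=
    (hasFDerivAt_fn h u hq.1).comp q hasFDerivAt_fst
  have h2 := ((hasFDerivAt_fib 1 q).const_mul s).exp
  have h3 := (hasDerivAt_inv hρ).comp_hasFDerivAt q (hasFDerivAt_fib 0 q)
  have h4 : HasFDerivAt (weighted s u) _ q := (h2.mul h3).mul h1
  rw [h4.fderiv]
  simp [fib]
  field_simp
  ring

/-- The equations Ω₁ = Ω₂ = 0 are solved for dρ/ρ and dφ. These suffice for differentiating weighted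
functions, which do not depend on f and g. -/
theorem fiber_components (h : IsSystem U F H) {q : Bundle} (hq : q ∈ bundleOver U) {v : Bundle}
    (h0 : bundleConn h 0 q v = 0) (h1 : bundleConn h 1 q v = 0) :
    v.2 0 / q.2 0 = -(1 / 2 * conn h 0 q.1 v.1)
      - q.2 2 / (2 * groupParam 1 q) * omega F H 3 q.1 v.1
      + q.2 3 / (2 * groupParam (-1) q) * omega F H 1 q.1 v.1 ∧
    v.2 1 = conn h 1 q.1 v.1 + q.2 2 / (2 * groupParam 1 q) * omega F H 3 q.1 v.1
      + q.2 3 / (2 * groupParam (-1) q) * omega F H 1 q.1 v.1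
      + (q.2 2 * q.2 3 / (2 * groupParam 1 q * groupParam (-1) q)
        + fn (torsI h) q.1 * q.2 2 / (4 * groupParam 1 q)
        + fn (torsJ h) q.1 * q.2 3 / (8 * groupParam (-1) q)) * omega F H 0 q.1 v.1 := by
  have hρ : q.2 0 ≠ 0 := hq.2.ne'
  have ha := groupParam_ne_zero 1 hq
  have hb := groupParam_ne_zero (-1) hq
  have ha' : groupParam 1 q = q.2 0 * Real.exp (1 * q.2 1) := rfl
  have hb' : groupParam (-1) q = q.2 0 * Real.exp (-1 * q.2 1) := rfl
  have hda : 1 / groupParam 1 q * groupParamD 1 q v = v.2 0 / q.2 0 + v.2 1 := by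
    rw [ha', groupParamD_apply]
    field_simp
  have hdb : 1 / groupParam (-1) q * groupParamD (-1) q v = v.2 0 / q.2 0 - v.2 1 := by
    rw [hb', groupParamD_apply]
    field_simp
    ring
  simp only [bundleConn, liftConnection, omegaLift, Matrix.cons_val, add_apply, sub_apply,
    smul_apply, smul_eq_mul, ContinuousLinearMap.comp_apply, ContinuousLinearMap.coe_fst'] at h0 h1
  have e1 : ∀ c : ℝ, 1 / (2 * c) = 1 / 2 * (1 / c) := fun c => by ring
  rw [hda, hdb] at h0
  rw [e1, e1, mul_assoc, mul_assoc, hda, hdb] at h1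
  constructor
  · linear_combination 1 / 2 * h0
  · linear_combination -h1

theorem I3lift_eq (h : IsSystem U F H) {q : Bundle} (hq : q ∈ bundleOver U) :
    I3lift F H q = weighted (-1) (torsI h) q := by
  rw [I3lift, weighted, I3_eq_fn h hq.1, neg_one_mul]

theorem lieD_congr {u k : Bundle → ℝ} (hU : IsOpen U) (huk : ∀ q ∈ bundleOver U, u q = k q)
    (X : Bundle → Bundle) {q : Bundle} (hq : q ∈ bundleOver U) :
    lieD X u q = fderiv ℝ k q (X q) := by
  have h1 : u =ᶠ[nhds q] k :=
    Filter.eventually_of_mem ((isOpen_bundleOver hU).mem_nhds hq) huk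
  rw [lieD, h1.fderiv_eq]

theorem kappa_of_omega (h : IsSystem U F H) {m : Jet} (hm : m ∈ U) (v : Jet) :
    kappa F H 0 m v = -omega F H 0 m v ∧ kappa F H 1 m v = omega F H 1 m v ∧
    kappa F H 2 m v = -omega F H 2 m v - 1 / 18 * fn h.ring.N m * omega F H 0 m v
      + 1 / 3 * fn (h.ring.d 4 h.ring.H) m * omega F H 1 m v ∧
    kappa F H 3 m v = omega F H 3 m v ∧
    kappa F H 4 m v = fn h.ring.G m * (-omega F H 4 m v - 1 / 18 * fn h.ring.M m * omega F H 0 m v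
      + 1 / 3 * fn h.ring.C m * omega F H 3 m v) := by
  have hG : ev ⟨m, hm⟩ (h.ring.d 3 (h.ring.d 3 h.ring.F)) * ev ⟨m, hm⟩ h.ring.G = 1 := by
    rw [← map_mul, h.ring.G_mul, map_one]
  simp only [omega_eq h _ hm, Fin.sum_univ_five, fn_eq _ hm, adapted]
  simp
  refine ⟨by ring, ?_⟩
  linear_combination -kappa F H 4 m v * hG

theorem omega_of_theta {q : Bundle} (hq : q ∈ bundleOver U) {v : Bundle}
    (h0 : theta F H 0 q v = 0) (h1 : theta F H 1 q v = 0) (h2 : theta F H 2 q v = 0)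
    (h3 : theta F H 3 q v = 0) (h4 : theta F H 4 q v = 1) :
    omega F H 0 q.1 v.1 = 0 ∧ omega F H 1 q.1 v.1 = 0 ∧ omega F H 2 q.1 v.1 = 0 ∧
    omega F H 3 q.1 v.1 = 0 ∧ omega F H 4 q.1 v.1 = groupParam 1 q / groupParam (-1) q := by
  have ha := groupParam_ne_zero 1 hq
  have hb := groupParam_ne_zero (-1) hq
  simp [theta_eq, Fin.sum_univ_five, groupMatrix, omegaLift, ha, hb] at h0 h1 h2 h3 h4
  simp only [h0, mul_zero, zero_add, mul_eq_zero, ha, hb, false_or, neg_zero] at h1 h2 h3 h4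
  simp only [h1, h3, mul_zero, zero_add, neg_zero, mul_eq_zero, div_eq_zero_iff, ha, hb,
    false_or] at h2 h4
  refine ⟨h0, h1, h2, h3, ?_⟩
  field_simp at h4
  field_simp
  linarith

/-- The derivative of the lift of `I³` along the fifth vector field. -/
theorem lieD_I3lift (h : IsSystem U F H) {X : Fin 5 → Bundle → Bundle}
    (hX : IsDualFrame U F H (bundleConn h) X) {q : Bundle} (hq : q ∈ bundleOver U) :
    lieD (X 4) (I3lift F H) q = weighted 1 (torsJ h) q := by
  have hρ : q.2 0 ≠ 0 := hq.2.ne'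
  obtain ⟨hθ, hΩ⟩ := hX q hq 4
  -- Along X₅ only ω⁵ survives, with value a/b. All terms in f and g of the fibre components
  -- therefore vanish, and the derivative is again a weighted function.
  obtain ⟨o0, o1, o2, o3, o4⟩ := omega_of_theta hq (hθ 0) (hθ 1) (hθ 2) (hθ 3) (hθ 4)
  obtain ⟨k0, k1, k2, k3, k4⟩ := kappa_of_omega h hq.1 (X 4 q).1
  obtain ⟨f0, f1⟩ := fiber_components h hq (hΩ 0) (hΩ 1)
  rw [lieD_congr h.isOpen (fun q hq => I3lift_eq h hq) _ hq, fderiv_weighted h _ _ hq, f0, f1]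
  simp only [dFun, conn, torsI, torsJ, connMatrix, add_apply, smul_apply,
    Fin.sum_univ_five, k0, k1, k2, k3, k4, o0, o1, o2, o3, o4, weighted, smul_eq_mul,
    fn_eq _ hq.1, JetRing.T5]
  simp [groupParam, Real.exp_neg]
  field_simp
  ring

end Lifting

/-! ### The derivatives of I³ on the unit section, and the structure equations on the bundle. -/

section UnitSection

variable {U : Set Jet} {F H : Jet → ℝ}

theorem unitSection_mem {m : Jet} (hm : m ∈ U) : unitSection m ∈ bundleOver U :=
  ⟨hm, by simp [unitSection]⟩

theorem theta_unitSection (i : Fin 5) (m : Jet) (v : Bundle) :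
    theta F H i (unitSection m) v = omega F H i m v.1 := by
  fin_cases i <;> simp [theta_eq, unitSection, groupParam, groupMatrix, omegaLift,
    Fin.sum_univ_five]

theorem I3_5_eq (h : IsSystem U F H) {X : Fin 5 → Bundle → Bundle}
    (hX : IsDualFrame U F H (bundleConn h) X) {m : Jet} (hm : m ∈ U) :
    I3_5 F H X m = fn (torsJ h) m := by
  rw [I3_5, lieD_I3lift h hX (unitSection_mem hm)]
  simp [weighted, unitSection]

theorem I3_4_eq (h : IsSystem U F H) {X : Fin 5 → Bundle → Bundle}
    (hX : IsDualFrame U F H (bundleConn h) X) {m : Jet} (hm : m ∈ U) :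
    I3_4 F H X m = 1 / 9 * fn h.ring.T4 m := by
  have hq := unitSection_mem hm
  obtain ⟨hθ, hΩ⟩ := hX _ hq 3
  simp only [theta_unitSection] at hθ
  obtain ⟨k0, k1, k2, k3, k4⟩ := kappa_of_omega h hm (X 3 (unitSection m)).1
  obtain ⟨f0, f1⟩ := fiber_components h hq (hΩ 0) (hΩ 1)
  rw [I3_4, lieD_congr h.isOpen (fun q hq => I3lift_eq h hq) _ hq, fderiv_weighted h _ _ hq, f0, f1]
  simp only [show (unitSection m).1 = m from rfl]
  simp only [dFun, conn, torsI, connMatrix, add_apply, smul_apply,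
    Fin.sum_univ_five, k0, k1, k2, k3, k4, hθ, smul_eq_mul,
    fn_eq _ hm, JetRing.T4, JetRing.T5]
  simp [unitSection, ev_ofNat]
  ring

theorem I3_52_eq (h : IsSystem U F H) {X : Fin 5 → Bundle → Bundle}
    (hX : IsDualFrame U F H (bundleConn h) X) {m : Jet} (hm : m ∈ U) :
    I3_52 F H X m = 1 / 9 * fn h.ring.T52 m := by
  have hq := unitSection_mem hm
  obtain ⟨hθ, hΩ⟩ := hX _ hq 1
  simp only [theta_unitSection] at hθ
  obtain ⟨k0, k1, k2, k3, k4⟩ := kappa_of_omega h hm (X 1 (unitSection m)).1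
  obtain ⟨f0, f1⟩ := fiber_components h hq (hΩ 0) (hΩ 1)
  -- A second derivative needs the first one on a neighbourhood, not only along the unit section;
  -- `lieD_I3lift` supplies it on the whole bundle.
  rw [I3_52, lieD_congr h.isOpen (fun q hq => lieD_I3lift h hX hq) _ hq, fderiv_weighted h _ _ hq,
    f0, f1]
  simp only [show (unitSection m).1 = m from rfl]
  simp only [dFun, conn, torsJ, connMatrix, add_apply, smul_apply,
    Fin.sum_univ_five, k0, k1, k2, k3, k4, hθ, smul_eq_mul,
    fn_eq _ hm, JetRing.T52]
  simp [unitSection, ev_ofNat]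
  ring

theorem exists_dualFrame (h : IsSystem U F H) : ∃ X, IsDualFrame U F H (bundleConn h) X := by
  have h1 : ∀ (j : Fin 5) (q : Bundle), ∃ v, q ∈ bundleOver U →
      (∀ i, theta F H i q v = if i = j then 1 else 0) ∧ ∀ a, bundleConn h a q v = 0 := by
    intro j q
    by_cases hq : q ∈ bundleOver U
    · obtain ⟨v, hv⟩ := exists_theta_eq h hq (fun i => if i = j then 1 else 0) 0
      exact ⟨v, fun _ => hv⟩
    -- Nothing is required of the frame off the bundle over U, so 0 serves as default.
    · exact ⟨0, fun hq' => absurd hq' hq⟩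
  choose X hX using h1
  exact ⟨X, fun q hq j => hX j q hq⟩

/-- A translation of `cartanEqs_theta` from a, b to ρ, φ, with e^(3φ)/ρ³ = 1/b³ and its analogues,
using the identified derivatives of I³. -/
theorem structureEquations_bundleConn (h : IsSystem U F H) {X : Fin 5 → Bundle → Bundle}
    (hX : IsDualFrame U F H (bundleConn h) X) {q : Bundle} (hq : q ∈ bundleOver U) :
    StructureEquations F H (bundleConn h) X q := by
  have hρ : q.2 0 ≠ 0 := hq.2.ne'
  have he : Real.exp (q.2 1) ≠ 0 := Real.exp_ne_zero _
  have e3 : Real.exp (3 * q.2 1) = Real.exp (q.2 1) ^ 3 := by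
    rw [← Real.exp_nat_mul]; norm_num
  have hQ : coeffQ F H X q = fn (torsQ h) q.1 / (groupParam 1 q * groupParam (-1) q)
        - I3 F H q.1 * q.2 2 / (2 * groupParam 1 q ^ 2 * groupParam (-1) q)
        + fn (torsJ h) q.1 * q.2 3 / (4 * groupParam 1 q * groupParam (-1) q ^ 2) := by
    simp only [coeffQ, I3_5_eq h hX hq.1, I3_4_eq h hX hq.1, I3_52_eq h hX hq.1, torsQ,
      fn_eq _ hq.1]
    simp [groupParam, Real.exp_neg, ev_ofNat]
    field_simp
    ring
  have c1 : Real.exp (3 * q.2 1) / q.2 0 ^ 3 * I1 H q.1 = I1 H q.1 / groupParam (-1) q ^ 3 := by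
    simp [groupParam, Real.exp_neg, e3]
    field_simp
  have c2 : Real.exp (-(3 * q.2 1)) / q.2 0 ^ 3 * I2 F q.1 = I2 F q.1 / groupParam 1 q ^ 3 := by
    simp [groupParam, Real.exp_neg, e3]
    field_simp
  have c3 : Real.exp (-q.2 1) / q.2 0 * I3 F H q.1 = I3 F H q.1 / groupParam 1 q := by
    simp [groupParam, Real.exp_neg]
    field_simp
  have c4 : Real.exp (q.2 1) / (2 * q.2 0) * I3_5 F H X q.1
      = fn (torsJ h) q.1 / groupParam (-1) q / 2 := by
    rw [I3_5_eq h hX hq.1]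
    simp [groupParam, Real.exp_neg]
    field_simp
  have hC := cartanEqs_theta h hq
  simp only [StructureEquations, hQ, c1, c2, c3, c4]
  refine ⟨?_, ?_, ?_, ?_, ?_⟩ <;> funext v w <;> obtain ⟨h0, h1, h2, h3, h4⟩ := hC v w
  · exact h0
  · simp only [h1, Pi.add_apply, Pi.sub_apply]
    simp [wedge]
    ring
  · exact h2
  · simp only [h3, Pi.neg_apply, Pi.sub_apply]
    simp [wedge]
    ring
  · exact h4

end UnitSection

/-! ### Uniqueness of the adapted coframe -/

section Pointwise

variable {E : Type*} [NormedAddCommGroup E] [NormedSpace ℝ E]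
  {dt ds : Fin 5 → E → E → ℝ} {t s : Fin 5 → E →L[ℝ] ℝ} {O P : Fin 4 → E →L[ℝ] ℝ}
  {i₁ i₂ i₃ j c k₁ k₂ k₃ l d : ℝ} {e : Fin 5 → E}

/-- First comparison of two coframes that satisfy structure equations. -/
theorem CartanEqs.compare_first (ht : CartanEqs dt t O i₁ i₂ i₃ j c)
    (hs : CartanEqs ds s P k₁ k₂ k₃ l d) (he : ∀ a b, t a (e b) = if a = b then 1 else 0)
    {u u' v v' : ℝ} {U U' V V' : E →L[ℝ] ℝ} (s0 : s 0 = t 0) (s1 : s 1 = t 1) (s3 : s 3 = t 3)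
    (s2 : s 2 = t 2 + u • t 1 + u' • t 0) (s4 : s 4 = t 4 + v • t 3 + v' • t 0)
    (d0 : ds 0 = dt 0) (d1 : ds 1 = dt 1) (d3 : ds 3 = dt 3)
    (d2 : ∀ x y, ds 2 x y = dt 2 x y + (wedge U (t 1) x y + u * dt 1 x y)
      + (wedge U' (t 0) x y + u' * dt 0 x y))
    (d4 : ∀ x y, ds 4 x y = dt 4 x y + (wedge V (t 3) x y + v * dt 3 x y)
      + (wedge V' (t 0) x y + v' * dt 0 x y)) : u = 0 ∧ v = 0 := by
  -- Let P₁, O₁ be the two versions of Ω₂. On e₃, dθ² at (e₁, e₃) gives P₁ = O₁ − u (dθ¹ at (e₀, e₃)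
  -- matches the versions of Ω₁), while dθ³ at (e₂, e₃) gives 2P₁ = 2O₁ + u; hence 3u = 0. Similarly
  -- on e₁, dθ⁴ gives P₁ = O₁ + v and dθ⁵ gives 2P₁ = 2O₁ − v.
  have t1 := (ht (e 1) (e 3)).2.1
  have t2 := (ht (e 0) (e 3)).1
  have t3 := (ht (e 2) (e 3)).2.2.1
  have p1 := (hs (e 1) (e 3)).2.1
  have p2 := (hs (e 0) (e 3)).1
  have p3 := (hs (e 2) (e 3)).2.2.1
  have t4 := (ht (e 0) (e 1)).1
  have t5 := (ht (e 1) (e 3)).2.2.2.1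
  have t6 := (ht (e 1) (e 4)).2.2.2.2
  have p4 := (hs (e 0) (e 1)).1
  have p5 := (hs (e 1) (e 3)).2.2.2.1
  have p6 := (hs (e 1) (e 4)).2.2.2.2
  have q1 := (ht (e 2) (e 3)).1
  have q2 := (ht (e 2) (e 3)).2.1
  have q3 := (ht (e 1) (e 4)).1
  have q4 := (ht (e 1) (e 4)).2.2.2.1
  rw [d2] at p3
  rw [d4] at p6
  simp [wedge, he, s0, s1, s2, s3, s4, d0, d1, d3] at t1 t2 t3 t4 t5 t6 p1 p2 p3 p4 p5 p6 q1 q2 q3 q4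
  rw [q2, q1] at p3
  rw [q4, q3] at p6
  constructor <;> linarith

/-- Second comparison of two coframes that satisfy structure equations. -/
theorem CartanEqs.compare_second (ht : CartanEqs dt t O i₁ i₂ i₃ j c)
    (hs : CartanEqs ds s P k₁ k₂ k₃ l d) (he : ∀ a b, t a (e b) = if a = b then 1 else 0)
    {u' v' : ℝ} {U' V' : E →L[ℝ] ℝ} (s0 : s 0 = t 0) (s1 : s 1 = t 1) (s3 : s 3 = t 3)
    (s2 : s 2 = t 2 + u' • t 0) (s4 : s 4 = t 4 + v' • t 0)
    (d1 : ds 1 = dt 1) (d3 : ds 3 = dt 3)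
    (d2 : ∀ x y, ds 2 x y = dt 2 x y + (wedge U' (t 0) x y + u' * dt 0 x y))
    (d4 : ∀ x y, ds 4 x y = dt 4 x y + (wedge V' (t 0) x y + v' * dt 0 x y)) :
    u' = 0 ∧ v' = 0 := by
  -- The value of Ω₃ on e₃ changes by u' according to dθ² at (e₀, e₃) and by −u' according to dθ³ at
  -- (e₁, e₃). Likewise Ω₄ on e₁, through dθ⁴ and dθ⁵, forces v' = 0.
  have t1 := (ht (e 0) (e 3)).2.1
  have t2 := (ht (e 1) (e 3)).2.2.1
  have p1 := (hs (e 0) (e 3)).2.1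
  have p2 := (hs (e 1) (e 3)).2.2.1
  have t3 := (ht (e 0) (e 1)).2.2.2.1
  have t4 := (ht (e 1) (e 3)).2.2.2.2
  have p3 := (hs (e 0) (e 1)).2.2.2.1
  have p4 := (hs (e 1) (e 3)).2.2.2.2
  have q1 := (ht (e 1) (e 3)).1
  rw [d2] at p2
  rw [d4] at p4
  simp [wedge, he, s0, s1, s2, s3, s4, d1, d3] at t1 t2 t3 t4 p1 p2 p3 p4 q1
  rw [q1] at p2 p4
  constructor <;> linarith

/-- The torsion coefficients `i₁`, `i₂`, `i₃` are determined by the coframe. -/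
theorem CartanEqs.torsion_unique (ht : CartanEqs dt t O i₁ i₂ i₃ j c)
    (hs : CartanEqs dt t P k₁ k₂ k₃ l d) (he : ∀ a b, t a (e b) = if a = b then 1 else 0) :
    k₁ = i₁ ∧ k₂ = i₂ ∧ k₃ = i₃ := by
  -- Here i₁ = dt₂(e₀, e₃) and i₂ = dt₄(e₀, e₁) directly, while i₃ = dt₂(e₁, e₂) + dt₄(e₁, e₄) −
  -- dt₁(e₀, e₂), in which the connection terms cancel.
  have t1 := (ht (e 0) (e 3)).2.2.1
  have t2 := (ht (e 0) (e 1)).2.2.2.2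
  have t3 := (ht (e 1) (e 2)).2.2.1
  have t4 := (ht (e 0) (e 2)).2.1
  have t5 := (ht (e 1) (e 4)).2.2.2.2
  have p1 := (hs (e 0) (e 3)).2.2.1
  have p2 := (hs (e 0) (e 1)).2.2.2.2
  have p3 := (hs (e 1) (e 2)).2.2.1
  have p4 := (hs (e 0) (e 2)).2.1
  have p5 := (hs (e 1) (e 4)).2.2.2.2
  simp [wedge, he] at t1 t2 t3 t4 t5 p1 p2 p3 p4 p5
  refine ⟨?_, ?_, ?_⟩ <;> linarith

/-- The diagonal of a change of coframe that respects the para-CR structure. -/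
theorem CartanEqs.diagonal {B : Matrix (Fin 5) (Fin 5) ℝ}
    {B' : Matrix (Fin 5) (Fin 5) (E →L[ℝ] ℝ)} (ht : CartanEqs dt t O i₁ i₂ i₃ j c)
    (hs : CartanEqs ds s P k₁ k₂ k₃ l d) (he : ∀ a b, t a (e b) = if a = b then 1 else 0)
    (hB : ∀ a, s a = ∑ b, B a b • t b)
    (hd : ∀ a x y, ds a x y = ∑ b, (wedge (B' a b) (t b) x y + B a b * dt b x y))
    (z0 : ∀ b, b ≠ 0 → B 0 b = 0 ∧ B' 0 b = 0)
    (z1 : B 1 3 = 0 ∧ B 1 4 = 0) (z3 : B 3 1 = 0 ∧ B 3 2 = 0) (h0 : B 0 0 ≠ 0) :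
    B 1 1 ≠ 0 ∧ B 3 3 ≠ 0 ∧ B 0 0 = B 1 1 * B 3 3 ∧ B 1 2 = 0 ∧ B 3 4 = 0 := by
  -- Modulo t₀ the derivative ds₀ is both B₀₀ t₁ ∧ t₃ and s₁ ∧ s₃; comparing coefficients gives the
  -- product formula and kills B₁₂ and B₃₄.
  have p1 := (hs (e 1) (e 3)).1
  have p2 := (hs (e 2) (e 3)).1
  have p3 := (hs (e 1) (e 4)).1
  have t1 := (ht (e 1) (e 3)).1
  have t2 := (ht (e 2) (e 3)).1
  have t3 := (ht (e 1) (e 4)).1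
  have y1 := z0 1 (by decide)
  have y2 := z0 2 (by decide)
  have y3 := z0 3 (by decide)
  have y4 := z0 4 (by decide)
  simp [wedge, he] at t1 t2 t3
  rw [hd] at p1 p2 p3
  simp [wedge, he, hB, Fin.sum_univ_five, y1, y2, y3, y4, z1, z3, t1, t2, t3] at p1 p2 p3
  have h1 : B 1 1 ≠ 0 := fun h => h0 (by rw [p1, h, zero_mul])
  have h3 : B 3 3 ≠ 0 := fun h => h0 (by rw [p1, h, mul_zero])
  refine ⟨h1, h3, p1, ?_, ?_⟩
  · simpa [h3, eq_comm] using p2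
  · simpa [h1, eq_comm] using p3

/-- This uses dθ² ≡ θ³ ∧ θ⁴ modulo θ¹, θ² and dθ⁴ ≡ −θ² ∧ θ⁵ modulo θ¹, θ⁴. It is separate from
`CartanEqs.diagonal` because it requires the differentials of the entries found there to vanish as
well. -/
theorem CartanEqs.diagonal' {B : Matrix (Fin 5) (Fin 5) ℝ}
    {B' : Matrix (Fin 5) (Fin 5) (E →L[ℝ] ℝ)} (ht : CartanEqs dt t O i₁ i₂ i₃ j c)
    (hs : CartanEqs ds s P k₁ k₂ k₃ l d) (he : ∀ a b, t a (e b) = if a = b then 1 else 0)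
    (hB : ∀ a, s a = ∑ b, B a b • t b)
    (hd : ∀ a x y, ds a x y = ∑ b, (wedge (B' a b) (t b) x y + B a b * dt b x y))
    (z0 : ∀ b, b ≠ 0 → B 0 b = 0)
    (z1 : ∀ b, 2 ≤ b → B 1 b = 0 ∧ B' 1 b = 0) (z2 : B 2 3 = 0 ∧ B 2 4 = 0)
    (z3 : ∀ b, b = 1 ∨ b = 2 ∨ b = 4 → B 3 b = 0 ∧ B' 3 b = 0)
    (z4 : B 4 1 = 0 ∧ B 4 2 = 0) :
    B 1 1 = B 2 2 * B 3 3 ∧ B 3 3 = B 1 1 * B 4 4 := by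
  have p1 := (hs (e 2) (e 3)).2.1
  have p2 := (hs (e 1) (e 4)).2.2.2.1
  have t1 := (ht (e 2) (e 3)).2.1
  have t2 := (ht (e 1) (e 4)).2.2.2.1
  have t3 := (ht (e 2) (e 3)).1
  have t4 := (ht (e 1) (e 4)).1
  have y1 := z0 1 (by decide)
  have y2 := z0 2 (by decide)
  have y3 := z0 3 (by decide)
  have y4 := z0 4 (by decide)
  have x2 := z1 2 (by decide)
  have x3 := z1 3 (by decide)
  have x4 := z1 4 (by decide)
  have w1 := z3 1 (by decide)
  have w2 := z3 2 (by decide)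
  have w4 := z3 4 (by decide)
  simp [wedge, he] at t1 t2 t3 t4
  rw [hd] at p1 p2
  simp [wedge, he, hB, Fin.sum_univ_five, y1, y2, y3, y4, x2, x3, x4, w1, w2, w4, z2, z4, t1, t2,
    t3, t4] at p1 p2
  constructor <;> linarith

end Pointwise

/-! ### Para-CR equivalences -/

section Equivalence

variable {U U' : Set Jet} {F H F' H' : Jet → ℝ} {Φ : Jet → Jet}

theorem eq_sum_omega_smul_frame (h : IsSystem U F H) {m : Jet} (hm : m ∈ U) (v : Jet) :
    v = ∑ j, omega F H j m v • frame h j m := by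
  set w := v - ∑ j, omega F H j m v • frame h j m with hw
  have h0 : ∀ i, omega F H i m w = 0 := fun i => by
    simp [hw, omega_frame h _ _ hm]
  obtain ⟨k0, k1, k2, k3, k4⟩ := kappa_of_omega h hm w
  simp [h0] at k0 k1 k2 k3 k4
  simp [kappa, dcoord] at k0 k1 k2 k3 k4
  rw [k4] at k0 k1 k2 k3
  simp at k3
  simp [k3] at k0 k1 k2
  have hw0 : w = 0 := by
    funext i
    fin_cases i <;> simp [k0, k1, k2, k3, k4]
  exact sub_eq_zero.1 hw0

theorem eq_sum_frame_smul_omega (h : IsSystem U F H) {m : Jet} (hm : m ∈ U) (α : Jet →L[ℝ] ℝ) :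
    α = ∑ j, α (frame h j m) • omega F H j m := by
  ext v
  conv_lhs => rw [eq_sum_omega_smul_frame h hm v]
  simp [mul_comm]

theorem contDiffOn_kappaFrame (h : IsSystem U F H) (i : Fin 5) :
    ContDiffOn ℝ ∞ (kappaFrame F H i) U := by
  have hF := h.smooth_F
  have hH := h.smooth_H
  have hDF := h.smooth_D hF
  have hD2F := h.smooth_D hDF
  have hFp := contDiffOn_pd h.isOpen hF 3
  have hc := contDiffOn_coord (U := U)
  have h3 := hc 3
  have h4 := hc 4
  fin_cases i
  · exact contDiffOn_const
  · exact contDiffOn_const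
  · exact contDiffOn_const
  · exact ((contDiffOn_const.add (h3.smul contDiffOn_const)).add (h4.smul contDiffOn_const)).add
      (hH.smul contDiffOn_const)
  · exact (((contDiffOn_const.sub (hFp.smul contDiffOn_const)).add
      ((hF.sub (hFp.mul h3)).smul contDiffOn_const)).add
      ((hDF.sub (hFp.mul h4)).smul contDiffOn_const)).add
      ((hD2F.sub (hFp.mul hH)).smul contDiffOn_const)

theorem contDiffOn_frame (h : IsSystem U F H) (j : Fin 5) : ContDiffOn ℝ ∞ (frame h j) U := by
  have he := contDiffOn_kappaFrame h
  have hc := contDiffOn_fn (U := U)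
  fin_cases j
  · exact ((he 0).neg.sub ((contDiffOn_const.mul (hc _)).smul (he 2))).sub
      ((contDiffOn_const.mul (hc _)).smul (he 4))
  · exact (he 1).add ((contDiffOn_const.mul (hc _)).smul (he 2))
  · exact (he 2).neg
  · exact (he 3).add ((contDiffOn_const.mul (hc _)).smul (he 4))
  · exact (hc _).neg.smul (he 4)

/-- The pull-back of the adapted coframe under `Φ`. -/
def pullbackOmega (F' H' : Jet → ℝ) (Φ : Jet → Jet) (i : Fin 5) (m : Jet) : Jet →L[ℝ] ℝ :=
  (omega F' H' i (Φ m)).comp (fderiv ℝ Φ m)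

theorem contDiffOn_pullbackOmega (hU : IsOpen U) (h' : IsSystem U' F' H')
    (hΦ : ContDiffOn ℝ ∞ Φ U) (hm : Set.MapsTo Φ U U') (i : Fin 5) :
    ContDiffOn ℝ ∞ (pullbackOmega F' H' Φ i) U :=
  ((contDiffOn_omega h' i).comp hΦ hm).clm_comp (hΦ.fderiv_of_isOpen hU (m := ∞) (by simp))

theorem cartanEqs_pullbackOmega (hU : IsOpen U) (h' : IsSystem U' F' H')
    (hΦ : ContDiffOn ℝ ∞ Φ U) (hmaps : Set.MapsTo Φ U U') {m : Jet} (hm : m ∈ U) :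
    ∃ O j c, CartanEqs (fun i => dForm (pullbackOmega F' H' Φ i) m)
      (fun i => pullbackOmega F' H' Φ i m) O (I1 H' (Φ m)) (I2 F' (Φ m)) (I3 F' H' (Φ m)) j c := by
  have h1 := (cartanEqs_base h' (hmaps hm)).comp (fderiv ℝ Φ m)
  have h2 : (fun i => dForm (pullbackOmega F' H' Φ i) m) = fun i v w =>
      dForm (omega F' H' i) (Φ m) (fderiv ℝ Φ m v) (fderiv ℝ Φ m w) := by
    funext i v w
    exact dForm_pullback (differentiableAt_of_smooth h'.isOpen (contDiffOn_omega h' i) (hmaps hm))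
      (hΦ.contDiffAt (hU.mem_nhds hm)) v w
  exact ⟨_, _, _, h2 ▸ h1⟩

theorem omega0_kappaFrame (F H : Jet → ℝ) (i j : Fin 5) (m : Jet) :
    omega0 F H i m (kappaFrame F H j m) =
      if i = j then 1 else if i = 3 ∧ j = 4 then -pd 3 F m else 0 := by
  fin_cases i <;> fin_cases j <;> simp [omega0, kappaFrame, dcoord] <;> ring

/-- The matrix of the pull-back of the adapted coframe. -/
def changeMatrix (h : IsSystem U F H) (F' H' : Jet → ℝ) (Φ : Jet → Jet) (m : Jet) :
    Matrix (Fin 5) (Fin 5) ℝ := fun i j => pullbackOmega F' H' Φ i m (frame h j m)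

theorem pullbackOmega_eq (h : IsSystem U F H) (F' H' : Jet → ℝ) (Φ : Jet → Jet) (i : Fin 5)
    {m : Jet} (hm : m ∈ U) : pullbackOmega F' H' Φ i m =
      ∑ j, changeMatrix h F' H' Φ m i j • omega F H j m :=
  eq_sum_frame_smul_omega h hm _

theorem isParaCRChange_zero_zero {A : Matrix (Fin 5) (Fin 5) ℝ} (hA : IsParaCRChange A) :
    A 0 0 ≠ 0 := by
  intro h0
  refine hA.1 (Matrix.det_eq_zero_of_row_eq_zero 0 fun j => ?_)
  by_cases hj : j = 0
  · rw [hj, h0]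
  · exact hA.2.1 j hj

/-- The matrix carrying the initial coframe to the adapted one respects the para-CR block form, and
so does the adapted frame, so the zeros of the pointwise matrix carry over. -/
theorem changeMatrix_shape (h : IsSystem U F H) (e : IsParaCREquivalence U F H U' F' H' Φ)
    {m : Jet} (hm : m ∈ U) :
    let B := changeMatrix h F' H' Φ m
    B 0 0 ≠ 0 ∧ (∀ j, j ≠ 0 → B 0 j = 0) ∧ (B 1 3 = 0 ∧ B 1 4 = 0) ∧ (B 2 3 = 0 ∧ B 2 4 = 0) ∧
      (B 3 1 = 0 ∧ B 3 2 = 0) ∧ (B 4 1 = 0 ∧ B 4 2 = 0) := by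
  obtain ⟨A, hA, hp⟩ := e.pullback m hm
  have h00 := isParaCRChange_zero_zero hA
  obtain ⟨-, hA0, a13, a14, a23, a24, a31, a32, a41, a42⟩ := hA
  have a01 := hA0 1 (by decide)
  have a02 := hA0 2 (by decide)
  have a03 := hA0 3 (by decide)
  have a04 := hA0 4 (by decide)
  have hv : ∀ i v, omega0 F' H' i (Φ m) (fderiv ℝ Φ m v) = ∑ j, A i j * omega0 F H j m v := by
    intro i v
    simpa using congrArg (fun l : Jet →L[ℝ] ℝ => l v) (hp i)
  have hB : ∀ i j, changeMatrix h F' H' Φ m i j = ∑ k, adaptMatrix F' H' (Φ m) i k *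
      ∑ l, A k l * omega0 F H l m (frame h j m) := by
    intro i j
    simp [changeMatrix, pullbackOmega, omega, hv]
  refine ⟨?_, fun j hj => ?_, ?_⟩
  · rw [hB]
    simpa [Fin.sum_univ_five, adaptMatrix, a01, a02, a03, a04, frame, omega0_kappaFrame] using h00
  · rw [hB]
    fin_cases j
    · exact absurd rfl hj
    all_goals simp [Fin.sum_univ_five, adaptMatrix, a01, a02, a03, a04, frame, omega0_kappaFrame]
  · simp only [hB]
    simp [Fin.sum_univ_five, adaptMatrix, a01, a02, a03, a04, a13, a14, a23, a24, a31, a32, a41,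
      a42, frame, omega0_kappaFrame]

/-- The definition of equivalence gives a matrix at each point without any regularity; contracting
with the smooth dual frame recovers smooth entries. -/
theorem contDiffOn_changeMatrix (h : IsSystem U F H) (h' : IsSystem U' F' H')
    (hΦ : ContDiffOn ℝ ∞ Φ U) (hmaps : Set.MapsTo Φ U U') (i j : Fin 5) :
    ContDiffOn ℝ ∞ (fun m => changeMatrix h F' H' Φ m i j) U :=
  (contDiffOn_pullbackOmega h.isOpen h' hΦ hmaps i).clm_apply (contDiffOn_frame h j)

theorem fderiv_eq_zero_of_eqOn (hU : IsOpen U) {k : Jet → ℝ} (hk : ∀ m ∈ U, k m = 0) {m : Jet}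
    (hm : m ∈ U) : fderiv ℝ k m = 0 := by
  have h1 : k =ᶠ[nhds m] fun _ => 0 := Filter.eventually_of_mem (hU.mem_nhds hm) hk
  rw [h1.fderiv_eq]
  simp

theorem dForm_add_smul_add_smul (hU : IsOpen U) {α β₀ β₁ β₂ : Jet → Jet →L[ℝ] ℝ} {k l : Jet → ℝ}
    (hα : ∀ m ∈ U, α m = β₀ m + k m • β₁ m + l m • β₂ m)
    (h₀ : ContDiffOn ℝ ∞ β₀ U) (h₁ : ContDiffOn ℝ ∞ β₁ U) (h₂ : ContDiffOn ℝ ∞ β₂ U)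
    (hk : ContDiffOn ℝ ∞ k U) (hl : ContDiffOn ℝ ∞ l U) {m : Jet} (hm : m ∈ U) (v w : Jet) :
    dForm α m v w = dForm β₀ m v w + (wedge (fderiv ℝ k m) (β₁ m) v w + k m * dForm β₁ m v w)
      + (wedge (fderiv ℝ l m) (β₂ m) v w + l m * dForm β₂ m v w) := by
  have h1 := dForm_sum_smul (c := ![fun _ => 1, k, l]) (c' := ![0, fderiv ℝ k m, fderiv ℝ l m])
    (α := ![β₀, β₁, β₂]) (q := m) ?_ ?_ v w
  · have h2 : α =ᶠ[nhds m] fun y => ∑ j : Fin 3, (![fun _ => 1, k, l] : Fin 3 → Jet → ℝ) j y •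
        (![β₀, β₁, β₂] : Fin 3 → Jet → Jet →L[ℝ] ℝ) j y :=
      Filter.eventually_of_mem (hU.mem_nhds hm) fun y hy => by simp [Fin.sum_univ_three, hα y hy]
    rw [dForm_congr h2, h1]
    simp [Fin.sum_univ_three, wedge]
  · intro j
    fin_cases j
    exacts [hasFDerivAt_const _ _, (differentiableAt_of_smooth hU hk hm).hasFDerivAt,
      (differentiableAt_of_smooth hU hl hm).hasFDerivAt]
  · intro j
    fin_cases j
    exacts [differentiableAt_of_smooth hU h₀ hm, differentiableAt_of_smooth hU h₁ hm,
      differentiableAt_of_smooth hU h₂ hm]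

/-- The diagonal blocks of the matrix of the pull-back. -/
theorem changeMatrix_diagonal (h : IsSystem U F H) (h' : IsSystem U' F' H')
    (e : IsParaCREquivalence U F H U' F' H' Φ) :
    (∀ m ∈ U, let B := changeMatrix h F' H' Φ m
      B 1 1 ≠ 0 ∧ B 3 3 ≠ 0 ∧ B 0 0 = B 1 1 * B 3 3 ∧ B 1 2 = 0 ∧ B 3 4 = 0) ∧
    ∀ m ∈ U, let B := changeMatrix h F' H' Φ m
      B 1 1 = B 2 2 * B 3 3 ∧ B 3 3 = B 1 1 * B 4 4 := by
  have hU := h.isOpen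
  have hsh := fun m hm => changeMatrix_shape h e (m := m) hm
  have hd : ∀ m ∈ U, ∀ i v w, dForm (pullbackOmega F' H' Φ i) m v w =
      ∑ b, (wedge (fderiv ℝ (fun y => changeMatrix h F' H' Φ y i b) m) (omega F H b m) v w
        + changeMatrix h F' H' Φ m i b * dForm (omega F H b) m v w) := by
    intro m hm i v w
    rw [dForm_congr (Filter.eventually_of_mem (hU.mem_nhds hm) fun y hy =>
      pullbackOmega_eq h F' H' Φ i hy)]
    exact dForm_sum_smul (fun j => (differentiableAt_of_smooth hU
      (contDiffOn_changeMatrix h h' e.smooth e.mapsTo i j) hm).hasFDerivAt)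
      (fun j => differentiableAt_of_smooth hU (contDiffOn_omega h j) hm) v w
  -- Vanishing on the open set U makes the differential vanish too. Hence the first block of
  -- relations is proved at all points before the second is begun.
  have hz : ∀ i j, (∀ m ∈ U, changeMatrix h F' H' Φ m i j = 0) → ∀ m ∈ U,
      fderiv ℝ (fun y => changeMatrix h F' H' Φ y i j) m = 0 :=
    fun i j hij m hm => fderiv_eq_zero_of_eqOn hU hij hm
  have key : ∀ m ∈ U, let B := changeMatrix h F' H' Φ m
      B 1 1 ≠ 0 ∧ B 3 3 ≠ 0 ∧ B 0 0 = B 1 1 * B 3 3 ∧ B 1 2 = 0 ∧ B 3 4 = 0 := by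
    intro m hm
    obtain ⟨O, j, c, hs⟩ := cartanEqs_pullbackOmega hU h' e.smooth e.mapsTo hm
    obtain ⟨s00, s0, s1, -, s3, -⟩ := hsh m hm
    exact (cartanEqs_base h hm).diagonal
      (B' := fun i b => fderiv ℝ (fun y => changeMatrix h F' H' Φ y i b) m) hs
      (fun a b => omega_frame h a b hm)
      (fun a => pullbackOmega_eq h F' H' Φ a hm) (hd m hm)
      (fun b hb => ⟨s0 b hb, hz 0 b (fun m hm => (hsh m hm).2.1 b hb) m hm⟩) s1 s3 s00
  refine ⟨key, fun m hm => ?_⟩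
  obtain ⟨O, j, c, hs⟩ := cartanEqs_pullbackOmega hU h' e.smooth e.mapsTo hm
  obtain ⟨s00, s0, s1, s2, s3, s4⟩ := hsh m hm
  have z1 : ∀ b : Fin 5, 2 ≤ b → ∀ m ∈ U, changeMatrix h F' H' Φ m 1 b = 0 := by
    intro b hb m hm
    obtain rfl | rfl | rfl : b = 2 ∨ b = 3 ∨ b = 4 := by omega
    exacts [(key m hm).2.2.2.1, (hsh m hm).2.2.1.1, (hsh m hm).2.2.1.2]
  have z3 : ∀ b : Fin 5, b = 1 ∨ b = 2 ∨ b = 4 → ∀ m ∈ U, changeMatrix h F' H' Φ m 3 b = 0 := by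
    rintro b (rfl | rfl | rfl) m hm
    exacts [(hsh m hm).2.2.2.2.1.1, (hsh m hm).2.2.2.2.1.2, (key m hm).2.2.2.2]
  exact (cartanEqs_base h hm).diagonal'
    (B' := fun i b => fderiv ℝ (fun y => changeMatrix h F' H' Φ y i b) m) hs
    (fun a b => omega_frame h a b hm)
    (fun a => pullbackOmega_eq h F' H' Φ a hm) (hd m hm) s0
    (fun b hb => ⟨z1 b hb m hm, hz 1 b (z1 b hb) m hm⟩) s2
    (fun b hb => ⟨z3 b hb m hm, hz 3 b (z3 b hb) m hm⟩) s4

theorem contDiffOn_groupMatrix {a b f g : Jet → ℝ} (ha : ContDiffOn ℝ ∞ a U)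
    (hb : ContDiffOn ℝ ∞ b U) (hf : ContDiffOn ℝ ∞ f U) (hg : ContDiffOn ℝ ∞ g U)
    (ha0 : ∀ m ∈ U, a m ≠ 0) (hb0 : ∀ m ∈ U, b m ≠ 0) (i l : Fin 5) :
    ContDiffOn ℝ ∞ (fun m => groupMatrix (a m) (b m) (f m) (g m) i l) U := by
  have hab : ContDiffOn ℝ ∞ (fun m => 2 * (a m * b m)) U := contDiffOn_const.mul (ha.mul hb)
  have hab0 : ∀ m ∈ U, 2 * (a m * b m) ≠ 0 := fun m hm =>
    mul_ne_zero two_ne_zero (mul_ne_zero (ha0 m hm) (hb0 m hm))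
  have h0 : ContDiffOn ℝ ∞ (fun _ : Jet => (0 : ℝ)) U := contDiffOn_const
  fin_cases i <;> fin_cases l
  exacts [ha.mul hb, h0, h0, h0, h0, hf, ha, h0, h0, h0, (hf.pow 2).div hab hab0, hf.div hb hb0,
    ha.div hb hb0, h0, h0, hg, h0, h0, hb, h0, ((hg.pow 2).div hab hab0).neg, h0, h0,
    (hg.div ha ha0).neg, hb.div ha ha0]

/-- The adapted coframe, moved by the reduced structure group. -/
def movedOmega (F H a b f g : Jet → ℝ) (i : Fin 5) (m : Jet) : Jet →L[ℝ] ℝ :=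
  ∑ l, groupMatrix (a m) (b m) (f m) (g m) i l • omega F H l m

/-- The same transport as on the bundle, now with the group parameters as functions on U. The
weights of I¹, I², I³ come from here. -/
theorem cartanEqs_movedOmega (h : IsSystem U F H) {a b f g : Jet → ℝ} (ha : ContDiffOn ℝ ∞ a U)
    (hb : ContDiffOn ℝ ∞ b U) (hf : ContDiffOn ℝ ∞ f U) (hg : ContDiffOn ℝ ∞ g U)
    (ha0 : ∀ m ∈ U, a m ≠ 0) (hb0 : ∀ m ∈ U, b m ≠ 0) {m : Jet} (hm : m ∈ U) :
    ∃ O j c, CartanEqs (fun i => dForm (movedOmega F H a b f g i) m)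
      (fun i => movedOmega F H a b f g i m) O
      (I1 H m / b m ^ 3) (I2 F m / a m ^ 3) (I3 F H m / a m) j c := by
  have hd : ∀ {k : Jet → ℝ}, ContDiffOn ℝ ∞ k U → HasFDerivAt k (fderiv ℝ k m) m :=
    fun hk => (differentiableAt_of_smooth h.isOpen hk hm).hasFDerivAt
  have h1 := (cartanEqs_base h hm).lift (ha0 m hm) (hb0 m hm) (f m) (g m) (fderiv ℝ a m)
    (fderiv ℝ b m) (fderiv ℝ f m) (fderiv ℝ g m)
  have h2 : ∀ i v w, dForm (movedOmega F H a b f g i) m v w = _ := fun i v w =>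
    dForm_sum_smul (fun l => hasFDerivAt_groupMatrix (hd ha) (hd hb) (hd hf) (hd hg)
      (ha0 m hm) (hb0 m hm) i l)
      (fun l => differentiableAt_of_smooth h.isOpen (contDiffOn_omega h l) hm) v w
  exact ⟨_, _, _, fun v w => by simp only [h2]; exact h1 v w⟩

theorem exists_movedOmega_frame (h : IsSystem U F H) {a b f g : Jet → ℝ} {m : Jet} (hm : m ∈ U)
    (ha : a m ≠ 0) (hb : b m ≠ 0) :
    ∃ e : Fin 5 → Jet, ∀ i j, movedOmega F H a b f g i m (e j) = if i = j then 1 else 0 := by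
  have h1 : ∀ j : Fin 5, ∃ v, ∀ i, movedOmega F H a b f g i m v = if i = j then 1 else 0 := by
    intro j
    obtain ⟨o, ho⟩ := exists_groupMatrix_mulVec_eq ha hb (f m) (g m) fun i => if i = j then 1 else 0
    obtain ⟨v, hv⟩ := exists_omega_eq h hm o
    exact ⟨v, fun i => by rw [← ho i]; simp [movedOmega, hv]⟩
  choose e he using h1
  exact ⟨e, fun i j => he j i⟩

/-- A para-CR equivalence moves the adapted coframe by the reduced structure group. -/
theorem exists_pullbackOmega_eq_movedOmega (h : IsSystem U F H) (h' : IsSystem U' F' H')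
    (e : IsParaCREquivalence U F H U' F' H' Φ) :
    ∃ a b f g : Jet → ℝ, ContDiffOn ℝ ∞ a U ∧ ContDiffOn ℝ ∞ b U ∧ ContDiffOn ℝ ∞ f U ∧
      ContDiffOn ℝ ∞ g U ∧ (∀ m ∈ U, a m ≠ 0) ∧ (∀ m ∈ U, b m ≠ 0) ∧
      ∀ m ∈ U, ∀ i, pullbackOmega F' H' Φ i m = movedOmega F H a b f g i m := by
  have hU := h.isOpen
  obtain ⟨hd, hd'⟩ := changeMatrix_diagonal h h' e
  have hsh := fun m hm => changeMatrix_shape h e (m := m) hm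
  have hB := contDiffOn_changeMatrix h h' e.smooth e.mapsTo
  set B := fun i j m => changeMatrix h F' H' Φ m i j with hBdef
  have ha := hB 1 1
  have hb := hB 3 3
  have hf := hB 1 0
  have hg := hB 3 0
  have ha0 : ∀ m ∈ U, B 1 1 m ≠ 0 := fun m hm => (hd m hm).1
  have hb0 : ∀ m ∈ U, B 3 3 m ≠ 0 := fun m hm => (hd m hm).2.1
  have hab0 : ∀ m ∈ U, B 1 1 m * B 3 3 m ≠ 0 := fun m hm => mul_ne_zero (ha0 m hm) (hb0 m hm)
  have hab0' : ∀ m ∈ U, 2 * (B 1 1 m * B 3 3 m) ≠ 0 := fun m hm =>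
    mul_ne_zero two_ne_zero (hab0 m hm)
  have hab : ContDiffOn ℝ ∞ (fun m => B 1 1 m * B 3 3 m) U := ha.mul hb
  have hab' : ContDiffOn ℝ ∞ (fun m => 2 * (B 1 1 m * B 3 3 m)) U := contDiffOn_const.mul hab
  -- The parameters a, b, f, g are read from rows 1 and 3 of the matrix. The functions `u`, `u'` and
  -- `k`, `k'` measure how far rows 2 and 4 are from the group shape, expressed in the moved coframe
  -- W.
  set u : Jet → ℝ := fun m => (B 2 1 m - B 1 0 m / B 3 3 m) / B 1 1 m with hu
  set u' : Jet → ℝ := fun m => (B 2 0 m - B 1 0 m ^ 2 / (2 * (B 1 1 m * B 3 3 m))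
    - u m * B 1 0 m) / (B 1 1 m * B 3 3 m) with hu'
  set k : Jet → ℝ := fun m => (B 4 3 m + B 3 0 m / B 1 1 m) / B 3 3 m with hk
  set k' : Jet → ℝ := fun m => (B 4 0 m + B 3 0 m ^ 2 / (2 * (B 1 1 m * B 3 3 m))
    - k m * B 3 0 m) / (B 1 1 m * B 3 3 m) with hk'
  have hus : ContDiffOn ℝ ∞ u U := ((hB 2 1).sub (hf.div hb hb0)).div ha ha0
  have hks : ContDiffOn ℝ ∞ k U := ((hB 4 3).add (hg.div ha ha0)).div hb hb0
  have hus' : ContDiffOn ℝ ∞ u' U :=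
    (((hB 2 0).sub ((hf.pow 2).div hab' hab0')).sub (hus.mul hf)).div hab hab0
  have hks' : ContDiffOn ℝ ∞ k' U :=
    (((hB 4 0).add ((hg.pow 2).div hab' hab0')).sub (hks.mul hg)).div hab hab0
  set W := movedOmega F H (B 1 1) (B 3 3) (B 1 0) (B 3 0) with hW
  have hWs : ∀ i, ContDiffOn ℝ ∞ (W i) U := fun i => ContDiffOn.sum fun l _ =>
    (contDiffOn_groupMatrix ha hb hf hg ha0 hb0 i l).smul (contDiffOn_omega h l)
  have hE : ∀ m ∈ U, pullbackOmega F' H' Φ 0 m = W 0 m ∧ pullbackOmega F' H' Φ 1 m = W 1 m ∧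
      pullbackOmega F' H' Φ 2 m = W 2 m + u m • W 1 m + u' m • W 0 m ∧
      pullbackOmega F' H' Φ 3 m = W 3 m ∧
      pullbackOmega F' H' Φ 4 m = W 4 m + k m • W 3 m + k' m • W 0 m := by
    intro m hm
    obtain ⟨-, s0, s1, s2, s3, s4⟩ := hsh m hm
    obtain ⟨d1, d3, d0, s12, s34⟩ := hd m hm
    obtain ⟨d2, d4⟩ := hd' m hm
    have d2' : changeMatrix h F' H' Φ m 2 2 = B 1 1 m / B 3 3 m := (eq_div_iff d3).2 d2.symm
    have d4' : changeMatrix h F' H' Φ m 4 4 = B 3 3 m / B 1 1 m :=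
      (eq_div_iff d1).2 (by rw [mul_comm]; exact d4.symm)
    have b1 := ha0 m hm
    have b3 := hb0 m hm
    have t1 := s0 1 (by decide)
    have t2 := s0 2 (by decide)
    have t3 := s0 3 (by decide)
    have t4 := s0 4 (by decide)
    have hr : ∀ i j, changeMatrix h F' H' Φ m i j = B i j m := fun i j => rfl
    have v1 : B 2 1 m = B 1 0 m / B 3 3 m + u m * B 1 1 m := by
      simp only [hu]
      field_simp
      ring
    have v2 : B 2 0 m = B 1 0 m ^ 2 / (2 * (B 1 1 m * B 3 3 m)) + u m * B 1 0 m
        + u' m * (B 1 1 m * B 3 3 m) := by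
      simp only [hu']
      field_simp
      ring
    have v3 : B 4 3 m = -(B 3 0 m / B 1 1 m) + k m * B 3 3 m := by
      simp only [hk]
      field_simp
      ring
    have v4 : B 4 0 m = -(B 3 0 m ^ 2 / (2 * (B 1 1 m * B 3 3 m))) + k m * B 3 0 m
        + k' m * (B 1 1 m * B 3 3 m) := by
      simp only [hk']
      field_simp
      ring
    simp only [pullbackOmega_eq h F' H' Φ _ hm, Fin.sum_univ_five, t1, t2, t3, t4, s1, s2, s3, s4,
      s12, s34, d0, d2', d4', hW, movedOmega]
    simp only [hr, v1, v2, v3, v4]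
    refine ⟨?_, ?_, ?_, ?_, ?_⟩ <;> ext x <;> simp [groupMatrix] <;> ring
  have hdE : ∀ i : Fin 5, (∀ m ∈ U, pullbackOmega F' H' Φ i m = W i m) → ∀ m ∈ U,
      dForm (pullbackOmega F' H' Φ i) m = dForm (W i) m := fun i hi m hm =>
    dForm_congr (Filter.eventually_of_mem (hU.mem_nhds hm) hi)
  have e0 := hdE 0 fun m hm => (hE m hm).1
  have e1 := hdE 1 fun m hm => (hE m hm).2.1
  have e3 := hdE 3 fun m hm => (hE m hm).2.2.2.1
  -- This must hold on all of U before the second comparison, so that the differentials of `u` and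
  -- `k` disappear as well.
  have huk : ∀ m ∈ U, u m = 0 ∧ k m = 0 := by
    intro m hm
    obtain ⟨O, j, c, hs⟩ := cartanEqs_pullbackOmega hU h' e.smooth e.mapsTo hm
    obtain ⟨P, l, d, ht⟩ := cartanEqs_movedOmega h ha hb hf hg ha0 hb0 hm
    obtain ⟨X, hX⟩ := exists_movedOmega_frame h (f := B 1 0) (g := B 3 0) hm (ha0 m hm) (hb0 m hm)
    obtain ⟨w0, w1, w2, w3, w4⟩ := hE m hm
    exact ht.compare_first hs hX w0 w1 w3 w2 w4 (e0 m hm) (e1 m hm) (e3 m hm)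
      (dForm_add_smul_add_smul hU (fun m hm => (hE m hm).2.2.1) (hWs 2) (hWs 1) (hWs 0) hus hus' hm)
      (dForm_add_smul_add_smul hU (fun m hm => (hE m hm).2.2.2.2) (hWs 4) (hWs 3) (hWs 0) hks hks'
        hm)
  have hE2 : ∀ m ∈ U, pullbackOmega F' H' Φ 2 m = W 2 m + u' m • W 0 m := fun m hm => by
    rw [(hE m hm).2.2.1, (huk m hm).1, zero_smul, add_zero]
  have hE4 : ∀ m ∈ U, pullbackOmega F' H' Φ 4 m = W 4 m + k' m • W 0 m := fun m hm => by
    rw [(hE m hm).2.2.2.2, (huk m hm).2, zero_smul, add_zero]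
  have huk' : ∀ m ∈ U, u' m = 0 ∧ k' m = 0 := by
    intro m hm
    obtain ⟨O, j, c, hs⟩ := cartanEqs_pullbackOmega hU h' e.smooth e.mapsTo hm
    obtain ⟨P, l, d, ht⟩ := cartanEqs_movedOmega h ha hb hf hg ha0 hb0 hm
    obtain ⟨X, hX⟩ := exists_movedOmega_frame h (f := B 1 0) (g := B 3 0) hm (ha0 m hm) (hb0 m hm)
    obtain ⟨w0, w1, -, w3, -⟩ := hE m hm
    have hz : ∀ y ∈ U, ∀ (α β : Jet →L[ℝ] ℝ), α + β = α + (0 : ℝ) • α + β := fun _ _ α β => by simp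
    refine ht.compare_second (U' := fderiv ℝ u' m) (V' := fderiv ℝ k' m) hs hX w0 w1 w3
      (hE2 m hm) (hE4 m hm) (e1 m hm) (e3 m hm) (fun x y => ?_) (fun x y => ?_)
    -- A zero multiple of W 2 fills the unused middle term.
    · have := dForm_add_smul_add_smul hU (k := fun _ => 0)
        (fun m hm => (hE2 m hm).trans (hz m hm _ _)) (hWs 2) (hWs 2) (hWs 0) contDiffOn_const hus'
        hm x y
      simpa [wedge] using this
    · have := dForm_add_smul_add_smul hU (k := fun _ => 0)
        (fun m hm => (hE4 m hm).trans (hz m hm _ _)) (hWs 4) (hWs 4) (hWs 0) contDiffOn_const hks'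
        hm x y
      simpa [wedge] using this
  refine ⟨B 1 1, B 3 3, B 1 0, B 3 0, ha, hb, hf, hg, ha0, hb0, fun m hm i => ?_⟩
  obtain ⟨w0, w1, -, w3, -⟩ := hE m hm
  fin_cases i
  · exact w0
  · exact w1
  · simpa [(huk' m hm).1] using hE2 m hm
  · exact w3
  · simpa [(huk' m hm).2] using hE4 m hm

end Equivalence

end ParaCR

end

/-! ### The theorem. -/

theorem theorem1p1 (U : Set ParaCR.Jet) (F H : ParaCR.Jet → ℝ) (hFH : ParaCR.IsSystem U F H) :
    (∃ (Ω : Fin 4 → ParaCR.Bundle → ParaCR.Bundle →L[ℝ] ℝ)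
        (X : Fin 5 → ParaCR.Bundle → ParaCR.Bundle),
      (∀ a, ContDiffOn ℝ ∞ (Ω a) (ParaCR.bundleOver U)) ∧
      (∀ q ∈ ParaCR.bundleOver U, LinearIndependent ℝ
        (Sum.elim (fun i : Fin 5 => ParaCR.theta F H i q) (fun a : Fin 4 => Ω a q))) ∧
      ParaCR.IsDualFrame U F H Ω X ∧
      ∀ q ∈ ParaCR.bundleOver U, ParaCR.StructureEquations F H Ω X q) ∧
    (∀ (U' : Set ParaCR.Jet) (F' H' : ParaCR.Jet → ℝ) (Φ : ParaCR.Jet → ParaCR.Jet),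
      ParaCR.IsSystem U' F' H' → ParaCR.IsParaCREquivalence U F H U' F' H' Φ →
      ∃ a b f g : ParaCR.Jet → ℝ,
        ContDiffOn ℝ ∞ a U ∧ ContDiffOn ℝ ∞ b U ∧ ContDiffOn ℝ ∞ f U ∧ ContDiffOn ℝ ∞ g U ∧
        ∀ m ∈ U, a m ≠ 0 ∧ b m ≠ 0 ∧
          (∀ i, (ParaCR.omega F' H' i (Φ m)).comp (fderiv ℝ Φ m) =
            ∑ j, ParaCR.groupMatrix (a m) (b m) (f m) (g m) i j • ParaCR.omega F H j m) ∧
          ParaCR.I1 H' (Φ m) = ParaCR.I1 H m / b m ^ 3 ∧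
          ParaCR.I2 F' (Φ m) = ParaCR.I2 F m / a m ^ 3 ∧
          ParaCR.I3 F' H' (Φ m) = ParaCR.I3 F H m / a m) := by
  constructor
  · obtain ⟨X, hX⟩ := ParaCR.exists_dualFrame hFH
    exact ⟨ParaCR.bundleConn hFH, X, ParaCR.contDiffOn_bundleConn hFH,
      fun q hq => ParaCR.linearIndependent_coframe hFH hq, hX,
      fun q hq => ParaCR.structureEquations_bundleConn hFH hX hq⟩
  · intro U' F' H' Φ h' e
    obtain ⟨a, b, f, g, ha, hb, hf, hg, ha0, hb0, hE⟩ :=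
      ParaCR.exists_pullbackOmega_eq_movedOmega hFH h' e
    refine ⟨a, b, f, g, ha, hb, hf, hg, fun m hm => ⟨ha0 m hm, hb0 m hm, hE m hm, ?_⟩⟩
    obtain ⟨O, j, c, hs⟩ :=
      ParaCR.cartanEqs_pullbackOmega hFH.isOpen h' e.smooth e.mapsTo hm
    obtain ⟨P, l, d, ht⟩ := ParaCR.cartanEqs_movedOmega hFH ha hb hf hg ha0 hb0 hm
    obtain ⟨X, hX⟩ := ParaCR.exists_movedOmega_frame hFH (f := f) (g := g) hm (ha0 m hm)
      (hb0 m hm)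
    have h1 : (fun i => ParaCR.dForm (ParaCR.pullbackOmega F' H' Φ i) m) =
        fun i => ParaCR.dForm (ParaCR.movedOmega F H a b f g i) m := funext fun i =>
      ParaCR.dForm_congr (Filter.eventually_of_mem (hFH.isOpen.mem_nhds hm) fun y hy => hE y hy i)
    have h2 : (fun i => ParaCR.pullbackOmega F' H' Φ i m) =
        fun i => ParaCR.movedOmega F H a b f g i m := funext (hE m hm)
    -- The pulled-back and the moved coframe now coincide together with their exterior derivatives,
    -- so two systems of structure equations hold for one coframe and their torsion agrees.
    rw [h1, h2] at hs
    exact ht.torsion_unique hs hX
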